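/- An overpartition of a nonnegative integer $n$ is a partition of $n$ in which the first occurrence of each distinct part may or may not be overlined. Let $\overline{p}(n)$ denote the number of overpartitions of $n$, with $\overline{p}(0)=1$. Then for every integer $n\ge 0$, \begin{align*} \overline{p}(80n+8)&\equiv 0 \pmod{25},\\ \overline{p}(80n+52)&\equiv 0 \pmod{25},\\ \overline{p}(80n+68)&\equiv 0 \pmod{25},\\ \overline{p}(80n+72)&\equiv 0 \pmod{25}. \end{align*} -/

import Mathlib

/-- An overpartition of `n`: a partition of `n` together with a set of part sizes occurring in it,
namely the sizes whose first occurrence is overlined. -/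
abbrev Overpartition (n : ℕ) : Type :=
  (p : Nat.Partition n) × {s : Finset ℕ // s ∈ p.parts.toFinset.powerset}

/-- The overpartition function: the number of overpartitions of `n`. -/
def overpartitionCount (n : ℕ) : ℕ :=
  Fintype.card (Overpartition n)

/-!
Write `E_k = ∏ (1 - q ^ (k n))`, `φ(q) = ∑ q ^ (n ^ 2)` and `ψ(q) = ∑_{n ≥ 0} q ^ (n (n + 1) / 2)`.
By the Jacobi triple product (`ramanujanTheta_eq`), `φ(-q) = E_1² / E_2` and `ψ(q) = E_2² / E_1`, so
the generating function of overpartitions is `E_2 / E_1² = 1 / φ(-q)`.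

*Sections.* Sorting squares by parity gives `φ(±q) = x ± y` with `x = φ(q⁴)`, `y = 2 q ψ(q⁸)`, and
`x⁴ - y⁴ = φ(-q⁴)⁴`. Expanding `1 / (x - y) = (x³ + x² y + x y² + y³) / φ(-q⁴)⁴` and keeping the
exponents divisible by `4` gives `∑ p̄(4n) qⁿ = φ(q)³ / φ(-q)⁴`; repeating this, the series
`∑ p̄(16n + 4) qⁿ` and `∑ p̄(16n + 8) qⁿ` are polynomials in `φ(q)`, `ψ(q²)` and `q` divided by
`φ(-q)¹⁶` (`exists_series_sixteen_mul`).

*Modulo 25.* By Frobenius there is a series `s` with `E_1⁵ = E_5 (1 - 5 s)`. Hence `φ(q)⁵`, `φ(-q)⁵`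
and `ψ(q²)⁵` are, modulo `25`, series in `q⁵` times `1 + 5 ℓ`, where `ℓ` is a linear combination of
`s(q)`, `s(q²)`, `s(q⁴)`. With `u = φ(q)⁴` and `v = 16 q ψ(q²)⁴` the remaining quadratic factors are
evaluated by

* `5 u v = 80 (s(q) - s(q²))` and `5 v² = 1280 (s(q²) - s(q⁴))` modulo `25`;
* `u² - u v + v² = 1 - 10 s(q²)` modulo `25`, a shadow of the identity of this form with `E₄`.

All corrections then cancel, and both sections have the form `F(q⁵) E_1` (times `q` for the second
one) modulo `25`, see `exists_redHom_eq`. By the pentagonal number theorem `E_1` has no exponents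
congruent to `3` or `4` modulo `5`, which gives the four progressions.

*The evaluations.* Splitting `ℤ²` along a sublattice of index `5` yields
`ψ(q)² - q ψ(q⁵)² = E_2 E_5³ / (E_1 E_10)` and `φ(-q⁵)² - φ(-q)² = 4 q E_1 E_10³ / (E_2 E_5)`. Together
they give `eulerProd_pow_five_sub`, which says `s(q) - s(q²) ≡ q ψ(q)⁸` modulo `5`. For
the third evaluation, `u² + 14 u v + v²` becomes `u² - u v + v²` under `q ↦ q²`, so that
`u² + 14 u v + v² - 1 + 10 s` is invariant under `q ↦ q²` modulo `25` with zero constant term, and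
therefore vanishes.
-/

open PowerSeries Filter Topology
open scoped PowerSeries.WithPiTopology

/-! ### q-binomial coefficients and the finite Jacobi triple product -/

/-- The triangular number `n (n + 1) / 2` for an integer `n`, as a natural number. -/
def tri (n : ℤ) : ℕ := (n * (n + 1) / 2).toNat

theorem two_mul_tri (n : ℤ) : 2 * (tri n : ℤ) = n * (n + 1) := by
  have h : n * (n + 1) / 2 * 2 = n * (n + 1) :=
    Int.ediv_mul_cancel (even_iff_two_dvd.mp (Int.even_mul_succ_self n))
  have h0 : 0 ≤ n * (n + 1) := by
    rcases le_or_gt 0 n with h | h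
    · positivity
    · nlinarith
  have : (0 : ℤ) ≤ n * (n + 1) / 2 := by positivity
  rw [tri, Int.toNat_of_nonneg this]
  linarith

/-- The Gaussian binomial coefficient with parameter `Q`, defined by the `Q`-Pascal rule. -/
def qBinom {R : Type*} [CommRing R] (Q : R) : ℕ → ℕ → R
  | _, 0 => 1
  | 0, _ + 1 => 0
  | n + 1, k + 1 => qBinom Q n k + Q ^ (k + 1) * qBinom Q n (k + 1)

section QBinom

variable {R : Type*} [CommRing R] (Q : R)

@[simp] theorem qBinom_zero_right (n : ℕ) : qBinom Q n 0 = 1 := by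
  cases n <;> rfl

theorem qBinom_eq_zero_of_lt : ∀ {n k : ℕ}, n < k → qBinom Q n k = 0
  | 0, _ + 1, _ => rfl
  | n + 1, k + 1, h => by
    rw [qBinom, qBinom_eq_zero_of_lt (by omega : n < k),
      qBinom_eq_zero_of_lt (by omega : n < k + 1)]
    ring

/-- The `q`-binomial theorem of Rothe, in homogeneous form. -/
theorem prod_add_mul_pow_eq_sum_qBinom (y : R) (n : ℕ) : ∀ z : R,
    ∏ k ∈ Finset.range n, (y + z * Q ^ k) =
      ∑ k ∈ Finset.range (n + 1), Q ^ k.choose 2 * qBinom Q n k * z ^ k * y ^ (n - k) := by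
  induction n with
  | zero => intro z; simp
  | succ n ih =>
    intro z
    rw [Finset.prod_range_succ']
    have h1 : ∀ k ∈ Finset.range n, y + z * Q ^ (k + 1) = y + (z * Q) * Q ^ k := by
      intro k _; ring
    rw [Finset.prod_congr rfl h1, ih (z * Q), Finset.sum_range_succ' _ (n + 1)]
    have h2 : ∀ k ∈ Finset.range (n + 1),
        Q ^ (k + 1).choose 2 * qBinom Q (n + 1) (k + 1) * z ^ (k + 1) * y ^ (n + 1 - (k + 1)) =
        z * (Q ^ k.choose 2 * qBinom Q n k * (z * Q) ^ k * y ^ (n - k)) +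
        Q ^ (k + 1).choose 2 * qBinom Q n (k + 1) * (z * Q) ^ (k + 1) * y ^ (n - k) := by
      intro k _
      rw [qBinom, Nat.choose_succ_succ' k 1, Nat.choose_one_right, Nat.add_sub_add_right]
      ring
    rw [Finset.sum_congr rfl h2, Finset.sum_add_distrib, ← Finset.mul_sum]
    have h3 : ∑ k ∈ Finset.range (n + 1),
        Q ^ (k + 1).choose 2 * qBinom Q n (k + 1) * (z * Q) ^ (k + 1) * y ^ (n - k) + y ^ (n + 1) =
        y * ∑ k ∈ Finset.range (n + 1), Q ^ k.choose 2 * qBinom Q n k * (z * Q) ^ k * y ^ (n - k)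
        := by
      rw [Finset.sum_range_succ, qBinom_eq_zero_of_lt Q (Nat.lt_succ_self n),
        Finset.sum_range_succ' _ n, mul_add, Finset.mul_sum]
      have h4 : ∀ k ∈ Finset.range n,
          Q ^ (k + 1).choose 2 * qBinom Q n (k + 1) * (z * Q) ^ (k + 1) * y ^ (n - k) =
          y * (Q ^ (k + 1).choose 2 * qBinom Q n (k + 1) * (z * Q) ^ (k + 1) *
            y ^ (n - (k + 1))) := by
        intro k hk
        have : n - k = n - (k + 1) + 1 := by have := Finset.mem_range.mp hk; omega
        rw [this]; ring
      rw [Finset.sum_congr rfl h4]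
      simp
      ring
    simp only [qBinom_zero_right, Nat.choose_zero_succ, pow_zero, mul_one, one_mul, Nat.sub_zero]
    linear_combination -h3

/-- The finite product `(1 - Q) (1 - Q ^ 2) ⋯ (1 - Q ^ n)`. -/
def qPoch (n : ℕ) : R := ∏ i ∈ Finset.range n, (1 - Q ^ (i + 1))

theorem qPoch_succ (n : ℕ) : qPoch Q (n + 1) = qPoch Q n * (1 - Q ^ (n + 1)) :=
  Finset.prod_range_succ _ _

theorem qBinom_mul_qPoch (n : ℕ) : ∀ k l : ℕ, k + l = n →
    qBinom Q n k * qPoch Q k * qPoch Q l = qPoch Q n := by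
  induction n with
  | zero =>
    intro k l h
    obtain ⟨rfl, rfl⟩ : k = 0 ∧ l = 0 := by omega
    simp [qPoch]
  | succ n ih =>
    intro k l h
    match k, l with
    | 0, l =>
      obtain rfl : l = n + 1 := by omega
      simp [qPoch]
    | k + 1, 0 =>
      obtain rfl : k = n := by omega
      have h1 := ih k 0 rfl
      rw [qBinom, qBinom_eq_zero_of_lt Q (Nat.lt_succ_self k), qPoch_succ]
      linear_combination (1 - Q ^ (k + 1)) * h1
    | k + 1, l + 1 =>
      have h1 := ih k (l + 1) (by omega)
      have h2 := ih (k + 1) l (by omega)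
      obtain rfl : n = k + l + 1 := by omega
      rw [qPoch_succ] at h1 h2
      rw [qBinom, qPoch_succ Q k, qPoch_succ Q l, qPoch_succ Q (k + l + 1)]
      linear_combination (1 - Q ^ (k + 1)) * h1 + Q ^ (k + 1) * (1 - Q ^ (l + 1)) * h2

end QBinom

/-- The finite Jacobi triple product: the homogeneous `q`-binomial theorem for `2 N` factors with
`y = Q ^ N`, `z = a` and `Q = a b`, after cancellation of a monomial. -/
theorem prod_eq_sum_qBinom {R : Type*} [CommRing R] [IsDomain R] {a b : R} (ha : a ≠ 0)
    (hb : b ≠ 0) (N : ℕ) :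
    (∏ k ∈ Finset.range N, (1 + a * (a * b) ^ k)) * ∏ k ∈ Finset.range N, (1 + b * (a * b) ^ k) =
      ∑ k ∈ Finset.range (2 * N + 1),
        qBinom (a * b) (2 * N) k * (a ^ tri (k - N) * b ^ tri (N - k)) := by
  have hQ : a * b ≠ 0 := mul_ne_zero ha hb
  have hne : a ^ N * (a * b) ^ (N.choose 2 + N * N) ≠ 0 :=
    mul_ne_zero (pow_ne_zero _ ha) (pow_ne_zero _ hQ)
  refine mul_left_cancel₀ hne ?_
  have h := prod_add_mul_pow_eq_sum_qBinom (a * b) ((a * b) ^ N) (2 * N) a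
  have key : ∏ k ∈ Finset.range (2 * N), ((a * b) ^ N + a * (a * b) ^ k) =
      a ^ N * (a * b) ^ (N.choose 2 + N * N) *
      ((∏ k ∈ Finset.range N, (1 + a * (a * b) ^ k)) *
        ∏ k ∈ Finset.range N, (1 + b * (a * b) ^ k)) := by
    rw [two_mul, Finset.prod_range_add]
    have e1 : ∏ k ∈ Finset.range N, ((a * b) ^ N + a * (a * b) ^ k) =
        a ^ N * (a * b) ^ N.choose 2 * ∏ k ∈ Finset.range N, (1 + b * (a * b) ^ k) := by
      have : ∀ k ∈ Finset.range N, (a * b) ^ N + a * (a * b) ^ k =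
          a * ((a * b) ^ k * (1 + b * (a * b) ^ (N - 1 - k))) := by
        intro k hk
        have hk' : N = k + (N - 1 - k) + 1 := by have := Finset.mem_range.mp hk; omega
        generalize N - 1 - k = j at *
        rw [hk']; ring
      rw [Finset.prod_congr rfl this, Finset.prod_mul_distrib, Finset.prod_mul_distrib,
        Finset.prod_const, Finset.card_range, Finset.prod_pow_eq_pow_sum,
        Finset.sum_range_id, ← Nat.choose_two_right,
        Finset.prod_range_reflect (fun k => 1 + b * (a * b) ^ k) N]
      ring
    have e2 : ∏ k ∈ Finset.range N, ((a * b) ^ N + a * (a * b) ^ (N + k)) =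
        (a * b) ^ (N * N) * ∏ k ∈ Finset.range N, (1 + a * (a * b) ^ k) := by
      have : ∀ k ∈ Finset.range N, (a * b) ^ N + a * (a * b) ^ (N + k) =
          (a * b) ^ N * (1 + a * (a * b) ^ k) := by intro k _; ring
      rw [Finset.prod_congr rfl this, Finset.prod_mul_distrib, Finset.prod_const,
        Finset.card_range, pow_mul]
    rw [e1, e2, pow_add]; ring
  rw [← key, h, Finset.mul_sum]
  refine Finset.sum_congr rfl fun k hk => ?_
  have hk : k ≤ 2 * N := by have := Finset.mem_range.mp hk; omega
  have hc : ∀ j : ℕ, 2 * (j.choose 2 : ℤ) = j * (j - 1) := by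
    intro j
    rw [Nat.choose_two_right]
    rcases j with _ | j
    · simp
    · have := Nat.div_mul_cancel (even_iff_two_dvd.mp (Nat.even_mul_pred_self (j + 1)))
      have h2 : ((((j + 1) * (j + 1 - 1) / 2 : ℕ) : ℤ)) * 2 = ((j + 1 : ℕ) * (j + 1 - 1 : ℕ) : ℤ) := by
        exact_mod_cast this
      rw [mul_comm, h2]; push_cast; simp
  have t1 := two_mul_tri ((k : ℤ) - N)
  have t2 := two_mul_tri ((N : ℤ) - k)
  have c1 := hc k
  have c2 := hc N
  have ea : k.choose 2 + k + N * (2 * N - k) = N + (N.choose 2 + N * N) + tri (k - N) := by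
    zify [hk]
    nlinarith
  have eb : k.choose 2 + N * (2 * N - k) = (N.choose 2 + N * N) + tri (N - k) := by
    zify [hk]
    nlinarith
  have ha' : a ^ (k.choose 2 + k + N * (2 * N - k)) =
      a ^ (N + (N.choose 2 + N * N) + tri (k - N)) := by rw [ea]
  have hb' : b ^ (k.choose 2 + N * (2 * N - k)) =
      b ^ ((N.choose 2 + N * N) + tri (N - k)) := by rw [eb]
  rw [← pow_mul, mul_pow, mul_pow a b (N * _), mul_pow a b (_ + _)]
  calc _ = qBinom (a * b) (2 * N) k * a ^ (k.choose 2 + k + N * (2 * N - k)) *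
        b ^ (k.choose 2 + N * (2 * N - k)) := by ring
    _ = _ := by rw [ha', hb']; ring

/-! ### Infinite products, theta series and the Jacobi triple product -/

theorem summable_of_finite_not_dvd {ι : Type*} {t : ι → ℤ⟦X⟧}
    (h : ∀ d : ℕ, {i | ¬ X ^ d ∣ t i}.Finite) : Summable t := by
  rw [WithPiTopology.summable_iff_summable_coeff]
  intro d
  refine summable_of_hasFiniteSupport ((h (d + 1)).subset fun i hi => ?_)
  simp only [Function.mem_support] at hi
  exact fun hd => hi (X_pow_dvd_iff.mp hd d (Nat.lt_succ_self d))

theorem multipliable_one_add_mul_pow (a Q : ℤ⟦X⟧) (hQ : constantCoeff Q = 0) :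
    Multipliable fun k : ℕ => 1 + a * Q ^ k := by
  refine WithPiTopology.multipliable_one_add_of_tendsto_order_atTop_nhds_top ℤ ?_
  refine ENat.tendsto_nhds_top_iff_natCast_lt.mpr fun n => eventually_atTop.mpr ⟨n + 1, ?_⟩
  intro m hm
  refine lt_of_lt_of_le (Nat.cast_lt.mpr (Nat.lt_of_succ_le hm)) ?_
  have : (X : ℤ⟦X⟧) ^ m ∣ a * Q ^ m :=
    Dvd.dvd.mul_left (pow_dvd_pow_of_dvd (X_dvd_iff.mpr hQ) m) a
  exact nat_le_order _ _ fun i hi => X_pow_dvd_iff.mp this i hi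

/-- Coefficientwise convergence over the discrete ring `ℤ`: convergent sequences of power series are
eventually constant modulo every power of `X`. -/
theorem eventually_X_pow_dvd_sub {f : ℕ → ℤ⟦X⟧} {F : ℤ⟦X⟧} (h : Tendsto f atTop (𝓝 F)) (d : ℕ) :
    ∀ᶠ n in atTop, X ^ d ∣ f n - F := by
  rw [WithPiTopology.tendsto_iff_coeff_tendsto] at h
  have h1 : ∀ j ∈ Finset.range d, ∀ᶠ n in atTop, coeff j (f n) = coeff j F := fun j _ => by
    have := h j
    rw [nhds_discrete, tendsto_pure] at this
    exact this
  filter_upwards [(eventually_all_finset _).mpr h1] with n hn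
  rw [X_pow_dvd_iff]
  intro m hm
  rw [map_sub, hn m (Finset.mem_range.mpr hm), sub_self]

/-- Ramanujan's theta series `f(a, b) = ∑ a ^ (n (n + 1) / 2) b ^ (n (n - 1) / 2)` over all integers
`n`. It converges as soon as `a b` has zero constant term. -/
noncomputable def ramanujanTheta (a b : ℤ⟦X⟧) : ℤ⟦X⟧ := ∑' n : ℤ, a ^ tri n * b ^ tri (-n)

theorem natAbs_le_tri_add_one (n : ℤ) : n.natAbs ≤ tri n + 1 := by
  have := two_mul_tri n
  zify
  rcases abs_cases n with ⟨h, _⟩ | ⟨h, _⟩ <;> rw [h] <;> nlinarith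

theorem X_pow_dvd_theta_term {a b : ℤ⟦X⟧} (hab : constantCoeff (a * b) = 0) {d : ℕ} {n : ℤ}
    (h : d + 1 ≤ n.natAbs) : X ^ d ∣ a ^ tri n * b ^ tri (-n) := by
  have h1 : d ≤ tri n := by have := natAbs_le_tri_add_one n; omega
  have h2 : d ≤ tri (-n) := by
    have := natAbs_le_tri_add_one (-n); rw [Int.natAbs_neg] at this; omega
  refine (pow_dvd_pow_of_dvd (X_dvd_iff.mpr hab) d).trans ?_
  rw [mul_pow]
  exact mul_dvd_mul (pow_dvd_pow a h1) (pow_dvd_pow b h2)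

theorem finite_not_dvd_theta_term {a b : ℤ⟦X⟧} (hab : constantCoeff (a * b) = 0) (d : ℕ) :
    {n : ℤ | ¬ X ^ d ∣ a ^ tri n * b ^ tri (-n)}.Finite := by
  refine (Set.finite_Icc (-(d : ℤ)) d).subset fun n hn => ?_
  by_contra hc
  refine hn (X_pow_dvd_theta_term hab ?_)
  rw [Set.mem_Icc] at hc
  omega

theorem hasSum_ramanujanTheta {a b : ℤ⟦X⟧} (hab : constantCoeff (a * b) = 0) :
    HasSum (fun n : ℤ => a ^ tri n * b ^ tri (-n)) (ramanujanTheta a b) :=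
  (summable_of_finite_not_dvd (finite_not_dvd_theta_term hab)).hasSum

theorem isUnit_of_constantCoeff_eq_one {f : ℤ⟦X⟧} (h : constantCoeff f = 1) : IsUnit f := by
  rw [isUnit_iff_constantCoeff, h]; exact isUnit_one

/-- The infinite product `∏ (1 - a Q ^ k)` over `k ≥ 0`, for `Q` with zero constant term. -/
noncomputable def qProd (a Q : ℤ⟦X⟧) : ℤ⟦X⟧ := ∏' k : ℕ, (1 - a * Q ^ k)

theorem hasProd_qProd (a : ℤ⟦X⟧) {Q : ℤ⟦X⟧} (hQ : constantCoeff Q = 0) :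
    HasProd (fun k : ℕ => 1 - a * Q ^ k) (qProd a Q) := by
  have := (multipliable_one_add_mul_pow (-a) Q hQ).hasProd
  simp only [neg_mul, ← sub_eq_add_neg] at this
  exact this

theorem tprod_one_add_mul_pow (a Q : ℤ⟦X⟧) : ∏' k : ℕ, (1 + a * Q ^ k) = qProd (-a) Q := by
  simp only [qProd, neg_mul, sub_neg_eq_add]

theorem tendsto_qPoch {Q : ℤ⟦X⟧} (hQ : constantCoeff Q = 0) :
    Tendsto (qPoch Q) atTop (𝓝 (qProd Q Q)) := by
  have := (hasProd_qProd Q hQ).tendsto_prod_nat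
  refine this.congr fun n => ?_
  exact Finset.prod_congr rfl fun k _ => by ring

theorem constantCoeff_eq_of_tendsto {f : ℕ → ℤ⟦X⟧} {F : ℤ⟦X⟧} {c : ℤ}
    (h : Tendsto f atTop (𝓝 F)) (hc : ∀ n, constantCoeff (f n) = c) : constantCoeff F = c := by
  have h1 := ((WithPiTopology.continuous_constantCoeff (R := ℤ)).tendsto F).comp h
  exact tendsto_nhds_unique h1 (by simp [Function.comp_def, hc])

theorem constantCoeff_qProd {a Q : ℤ⟦X⟧} (ha : constantCoeff a = 0) (hQ : constantCoeff Q = 0) :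
    constantCoeff (qProd a Q) = 1 :=
  constantCoeff_eq_of_tendsto (hasProd_qProd a hQ).tendsto_prod_nat fun n => by simp [ha]

/-- If `k` and `l` are large, `qBinom Q (k + l) k` is close to the inverse of `∏ (1 - Q ^ n)`. -/
theorem exists_forall_dvd_qProd_mul_qBinom_sub_one {Q : ℤ⟦X⟧} (hQ : constantCoeff Q = 0) (d : ℕ) :
    ∃ M : ℕ, ∀ k l : ℕ, M ≤ k → M ≤ l → X ^ d ∣ qProd Q Q * qBinom Q (k + l) k - 1 := by
  obtain ⟨M, hM⟩ := eventually_atTop.mp (eventually_X_pow_dvd_sub (tendsto_qPoch hQ) d)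
  refine ⟨M, fun k l hk hl => ?_⟩
  obtain ⟨x, hx⟩ := hM k hk
  obtain ⟨y, hy⟩ := hM l hl
  obtain ⟨z, hz⟩ := hM (k + l) (by omega)
  have h := qBinom_mul_qPoch Q (k + l) k l rfl
  rw [sub_eq_iff_eq_add] at hx hy hz
  rw [hx, hy, hz] at h
  have hu := isUnit_of_constantCoeff_eq_one (constantCoeff_qProd hQ hQ)
  refine (IsUnit.dvd_mul_right hu).mp ⟨z - qBinom Q (k + l) k * (x * qProd Q Q + y * qProd Q Q +
    X ^ d * x * y), ?_⟩
  linear_combination h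

/-- The Jacobi triple product identity. -/
theorem ramanujanTheta_eq {a b : ℤ⟦X⟧} (hab : constantCoeff (a * b) = 0) (ha : a ≠ 0)
    (hb : b ≠ 0) : ramanujanTheta a b =
      qProd (-a) (a * b) * qProd (-b) (a * b) * qProd (a * b) (a * b) := by
  rw [← tprod_one_add_mul_pow, ← tprod_one_add_mul_pow]
  set Q := a * b with hQ
  have h1 := (multipliable_one_add_mul_pow a Q hab).hasProd.tendsto_prod_nat
  have h2 := (multipliable_one_add_mul_pow b Q hab).hasProd.tendsto_prod_nat
  have h3 := ((h1.mul h2).mul_const (qProd Q Q))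
  refine tendsto_nhds_unique ?_ h3
  rw [WithPiTopology.tendsto_iff_coeff_tendsto]
  intro d
  obtain ⟨M, hM⟩ := exists_forall_dvd_qProd_mul_qBinom_sub_one hab (d + 1)
  have hS := (WithPiTopology.hasSum_iff_hasSum_coeff (R := ℤ)).mp (hasSum_ramanujanTheta hab) d
  rw [nhds_discrete, tendsto_pure]
  filter_upwards [eventually_ge_atTop (M + d + 2)] with N hN
  rw [hQ, prod_eq_sum_qBinom ha hb N, ← hQ, Finset.sum_mul, map_sum]
  rw [← hS.tsum_eq]
  have hcz : ∀ g : ℤ⟦X⟧, ∀ n : ℤ, d + 2 ≤ n.natAbs →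
      coeff d (g * (a ^ tri n * b ^ tri (-n))) = 0 := fun g n hn =>
    X_pow_dvd_iff.mp (Dvd.dvd.mul_left (X_pow_dvd_theta_term (d := d + 1) hab (by omega)) g) d
      (Nat.lt_succ_self d)
  -- only the indices `|n| ≤ d + 1` contribute to the coefficient of degree `d`
  have hsub : ∑' n : ℤ, coeff d (a ^ tri n * b ^ tri (-n)) =
      ∑ k ∈ Finset.range (2 * N + 1), coeff d (a ^ tri (k - N : ℤ) * b ^ tri (-(k - N : ℤ))) := by
    rw [tsum_eq_sum (s := (Finset.range (2 * N + 1)).image fun k : ℕ => (k - N : ℤ))]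
    · rw [Finset.sum_image]
      intro x _ y _ hxy
      simp only at hxy
      omega
    · intro n hn
      have : d + 2 ≤ n.natAbs := by
        by_contra hc
        refine hn (Finset.mem_image.mpr ⟨(n + N).toNat, ?_, ?_⟩)
        · rw [Finset.mem_range]; omega
        · omega
      simpa using hcz 1 n this
  rw [hsub]
  refine Finset.sum_congr rfl fun k hk => ?_
  have hk' : k ≤ 2 * N := by have := Finset.mem_range.mp hk; omega
  rw [neg_sub]
  -- for small `|k - N|` the `q`-binomial coefficient has stabilised up to degree `d`
  by_cases hc : d + 2 ≤ (k - N : ℤ).natAbs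
  · have e1 := hcz (qBinom Q (2 * N) k * qProd Q Q) _ hc
    have e2 := hcz 1 _ hc
    rw [neg_sub] at e1 e2
    rw [one_mul] at e2
    rw [e2, ← e1]
    congr 1
    ring
  · have hd := hM k (2 * N - k) (by omega) (by omega)
    rw [show k + (2 * N - k) = 2 * N by omega] at hd
    have := X_pow_dvd_iff.mp (Dvd.dvd.mul_right hd (a ^ tri (k - N : ℤ) * b ^ tri (N - k : ℤ))) d
      (Nat.lt_succ_self d)
    rw [sub_mul, map_sub, sub_eq_zero, one_mul] at this
    rw [← this]
    congr 1
    ring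

/-! ### Theta series under changes of the summation lattice -/

theorem qProd_mul_qProd_neg (a : ℤ⟦X⟧) {Q : ℤ⟦X⟧} (hQ : constantCoeff Q = 0) :
    qProd a Q * qProd (-a) Q = qProd (a ^ 2) (Q ^ 2) := by
  have h := (hasProd_qProd a hQ).mul (hasProd_qProd (-a) hQ)
  refine h.unique ?_
  convert hasProd_qProd (a ^ 2) (Q := Q ^ 2) (by simp [hQ]) using 2
  ring

theorem qProd_eq_one_sub_mul (a : ℤ⟦X⟧) {Q : ℤ⟦X⟧} (hQ : constantCoeff Q = 0) :
    qProd a Q = (1 - a) * qProd (a * Q) Q := by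
  refine tendsto_nhds_unique ((tendsto_add_atTop_iff_nat 1).mpr
    (hasProd_qProd a hQ).tendsto_prod_nat) ?_
  refine ((hasProd_qProd (a * Q) hQ).tendsto_prod_nat.const_mul (1 - a)).congr fun n => ?_
  rw [Finset.prod_range_succ', mul_comm]
  congr 1
  · exact Finset.prod_congr rfl fun k _ => by ring
  · ring

theorem qProd_eq_prod_qProd_pow (a : ℤ⟦X⟧) {Q : ℤ⟦X⟧} (hQ : constantCoeff Q = 0) {d : ℕ}
    (hd : d ≠ 0) : qProd a Q = ∏ j ∈ Finset.range d, qProd (a * Q ^ j) (Q ^ d) := by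
  have h1 := tendsto_finsetProd (Finset.range d) fun j _ =>
    (hasProd_qProd (a * Q ^ j) (Q := Q ^ d) (by simp [hQ, hd])).tendsto_prod_nat
  have h2 := (hasProd_qProd a hQ).tendsto_prod_nat.comp
    (tendsto_id.atTop_mul_const' (Nat.pos_of_ne_zero hd))
  refine tendsto_nhds_unique h2 (h1.congr fun n => ?_)
  simp only [Function.comp_apply, id]
  induction n with
  | zero => simp
  | succ n ih =>
    rw [Nat.succ_mul, Finset.prod_range_add, ← ih, ← Finset.prod_mul_distrib]
    refine Finset.prod_congr rfl fun j _ => ?_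
    rw [Finset.prod_range_succ]
    ring

theorem continuous_expand {d : ℕ} (hd : d ≠ 0) :
    Continuous (expand d hd : ℤ⟦X⟧ → ℤ⟦X⟧) := by
  rw [continuous_iff_continuousAt]
  intro f
  refine (WithPiTopology.tendsto_iff_coeff_tendsto ..).mpr fun n => ?_
  simp only [coeff_expand]
  split_ifs
  · exact (WithPiTopology.continuous_coeff ℤ _).tendsto f
  · exact tendsto_const_nhds

theorem expand_qProd {d : ℕ} (hd : d ≠ 0) (a : ℤ⟦X⟧) {Q : ℤ⟦X⟧} (hQ : constantCoeff Q = 0) :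
    expand d hd (qProd a Q) = qProd (expand d hd a) (expand d hd Q) := by
  have h := (hasProd_qProd a hQ).map (expand d hd) (continuous_expand hd)
  refine h.unique ?_
  convert hasProd_qProd (expand d hd a) (Q := expand d hd Q) (by simp [hQ]) using 2
  simp

theorem expand_ramanujanTheta {d : ℕ} (hd : d ≠ 0) {a b : ℤ⟦X⟧} (hab : constantCoeff (a * b) = 0) :
    expand d hd (ramanujanTheta a b) = ramanujanTheta (expand d hd a) (expand d hd b) := by
  have h := (hasSum_ramanujanTheta hab).map (expand d hd) (continuous_expand hd)
  refine h.unique ?_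
  convert hasSum_ramanujanTheta (a := expand d hd a) (b := expand d hd b) (by
    rw [← map_mul, constantCoeff_expand, hab]) using 2
  simp

theorem ramanujanTheta_comm {a b : ℤ⟦X⟧} (hab : constantCoeff (a * b) = 0) :
    ramanujanTheta a b = ramanujanTheta b a := by
  have h := (Equiv.neg ℤ).hasSum_iff.mpr (hasSum_ramanujanTheta hab)
  refine h.unique ?_
  convert hasSum_ramanujanTheta (a := b) (b := a) (by rw [mul_comm, hab]) using 2 with n
  simp [mul_comm]

theorem hasSum_ramanujanTheta_mul {a b c d : ℤ⟦X⟧} (hab : constantCoeff (a * b) = 0)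
    (hcd : constantCoeff (c * d) = 0) :
    HasSum (fun p : ℤ × ℤ => (a ^ tri p.1 * b ^ tri (-p.1)) * (c ^ tri p.2 * d ^ tri (-p.2)))
      (ramanujanTheta a b * ramanujanTheta c d) := by
  have hs : Summable fun p : ℤ × ℤ =>
      (a ^ tri p.1 * b ^ tri (-p.1)) * (c ^ tri p.2 * d ^ tri (-p.2)) := by
    refine summable_of_finite_not_dvd fun n => ?_
    refine ((finite_not_dvd_theta_term hab n).prod (finite_not_dvd_theta_term hcd n)).subset ?_
    rintro ⟨p, q⟩ h
    exact ⟨fun hc => h (Dvd.dvd.mul_right hc _), fun hc => h (Dvd.dvd.mul_left hc _)⟩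
  have h1 := hasSum_ramanujanTheta hab
  have h2 := hasSum_ramanujanTheta hcd
  have h3 := hs.hasSum.prod_fiberwise fun i => h2.mul_left (a ^ tri i * b ^ tri (-i))
  rw [(h1.mul_right (ramanujanTheta c d)).unique h3]
  exact hs.hasSum

theorem cast_tri (n : ℤ) : (tri n : ℚ) = n * (n + 1) / 2 := by
  have h : ((2 * (tri n : ℤ) : ℤ) : ℚ) = ((n * (n + 1) : ℤ) : ℚ) := by rw [two_mul_tri]
  push_cast at h
  linarith

/-- The cosets of the sublattice `{(2 a - b, a + 2 b)}` of index `5` in `ℤ × ℤ`, that is, of the ideal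
`(2 + i)` of the Gaussian integers, shifted by `s` in the second coordinate. -/
def latticeEquiv (s : ℤ) : Fin 5 × (ℤ × ℤ) ≃ ℤ × ℤ where
  toFun p := (2 * p.2.1 - p.2.2 + (p.1 : ℕ), p.2.1 + 2 * p.2.2 + s)
  invFun q :=
    (⟨((q.1 - 2 * (q.2 - s)) % 5).toNat, by omega⟩,
      (q.2 - s + 2 * ((q.1 - 2 * (q.2 - s)) / 5), -((q.1 - 2 * (q.2 - s)) / 5)))
  left_inv := by
    rintro ⟨⟨r, hr⟩, a, b⟩
    have h1 : 2 * a - b + (r : ℤ) - 2 * (a + 2 * b + s - s) = r + 5 * (-b) := by ring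
    have h2 : ((r : ℤ) + 5 * (-b)) % 5 = r := by omega
    have h3 : ((r : ℤ) + 5 * (-b)) / 5 = -b := by omega
    simp only [h1, h2, h3, Prod.mk.injEq, Fin.mk.injEq]
    refine ⟨by simp, by ring, by ring⟩
  right_inv := by
    rintro ⟨m, n⟩
    simp only [Prod.mk.injEq]
    refine ⟨?_, by ring⟩
    omega

theorem eq_sum_of_hasSum_latticeEquiv {F : ℤ × ℤ → ℤ⟦X⟧} {S : ℤ⟦X⟧} (hF : HasSum F S) (s : ℤ)
    (g : Fin 5 → ℤ⟦X⟧) (hg : ∀ r, HasSum (fun p => F (latticeEquiv s (r, p))) (g r)) :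
    S = ∑ r, g r :=
  (HasSum.prod_fiberwise ((latticeEquiv s).hasSum_iff.mpr hF) hg).unique (hasSum_fintype g)

/-- Change of variables by a translation of `ℤ × ℤ`, used to recentre the quadratic exponents. -/
theorem hasSum_of_hasSum_shift {F G : ℤ × ℤ → ℤ⟦X⟧} {S : ℤ⟦X⟧} (hG : HasSum G S) (s t : ℤ)
    (h : ∀ a b, F (a + s, b + t) = G (a, b)) : HasSum F S := by
  rw [← ((Equiv.addRight s).prodCongr (Equiv.addRight t)).hasSum_iff]
  convert hG using 1
  ext1 ⟨a, b⟩
  exact h a b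

/-- Sums of two squares sorted by the cosets of `(2 + i)`: the trivial coset gives `φ(Z ^ 5) ^ 2`, and the
other four, which the units permute, give the same product of two theta series. -/
theorem ramanujanTheta_sq_sub {Z : ℤ⟦X⟧} (hZ : constantCoeff Z = 0) :
    ramanujanTheta Z Z ^ 2 = ramanujanTheta (Z ^ 5) (Z ^ 5) ^ 2 +
      4 * Z * (ramanujanTheta Z (Z ^ 9) * ramanujanTheta (Z ^ 3) (Z ^ 7)) := by
  have hc : ∀ i j : ℕ, i ≠ 0 → constantCoeff (Z ^ i * Z ^ j) = 0 := by
    intro i j hi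
    simp [hZ, hi]
  have hF := hasSum_ramanujanTheta_mul (hc 1 1 one_ne_zero) (hc 1 1 one_ne_zero)
  have e1 := ramanujanTheta_comm (hc 1 9 (by norm_num))
  have e3 := ramanujanTheta_comm (hc 3 7 (by norm_num))
  have h := eq_sum_of_hasSum_latticeEquiv hF 0
    ![ramanujanTheta (Z ^ 5) (Z ^ 5) * ramanujanTheta (Z ^ 5) (Z ^ 5),
      Z * (ramanujanTheta (Z ^ 9) (Z ^ 1) * ramanujanTheta (Z ^ 3) (Z ^ 7)),
      Z * (ramanujanTheta (Z ^ 3) (Z ^ 7) * ramanujanTheta (Z ^ 1) (Z ^ 9)),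
      Z * (ramanujanTheta (Z ^ 7) (Z ^ 3) * ramanujanTheta (Z ^ 9) (Z ^ 1)),
      Z * (ramanujanTheta (Z ^ 1) (Z ^ 9) * ramanujanTheta (Z ^ 7) (Z ^ 3))] ?_
  · simp only [Fin.sum_univ_five, Matrix.cons_val, ← e1, ← e3] at h
    simp only [pow_one] at h
    linear_combination h
  · intro r
    fin_cases r
    · refine hasSum_of_hasSum_shift (hasSum_ramanujanTheta_mul (hc 5 5 (by norm_num))
        (hc 5 5 (by norm_num))) 0 0 fun a b => ?_
      simp only [latticeEquiv, Equiv.coe_fn_mk, ← pow_mul, ← pow_add]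
      congr 1
      rw [← Nat.cast_inj (R := ℚ)]
      push_cast [cast_tri]
      ring
    · refine hasSum_of_hasSum_shift ((hasSum_ramanujanTheta_mul (hc 9 1 (by norm_num))
        (hc 3 7 (by norm_num))).mul_left Z) 0 0 fun a b => ?_
      simp only [latticeEquiv, Equiv.coe_fn_mk, ← pow_mul, ← pow_add, ← pow_succ']
      congr 1
      rw [← Nat.cast_inj (R := ℚ)]
      push_cast [cast_tri]
      ring
    · refine hasSum_of_hasSum_shift ((hasSum_ramanujanTheta_mul (hc 3 7 (by norm_num))
        (hc 1 9 (by norm_num))).mul_left Z) (-1) 0 fun a b => ?_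
      simp only [latticeEquiv, Equiv.coe_fn_mk, ← pow_mul, ← pow_add, ← pow_succ']
      congr 1
      rw [← Nat.cast_inj (R := ℚ)]
      push_cast [cast_tri]
      ring
    · refine hasSum_of_hasSum_shift ((hasSum_ramanujanTheta_mul (hc 7 3 (by norm_num))
        (hc 9 1 (by norm_num))).mul_left Z) (-1) 1 fun a b => ?_
      simp only [latticeEquiv, Equiv.coe_fn_mk, ← pow_mul, ← pow_add, ← pow_succ']
      congr 1
      rw [← Nat.cast_inj (R := ℚ)]
      push_cast [cast_tri]
      ring
    · refine hasSum_of_hasSum_shift ((hasSum_ramanujanTheta_mul (hc 1 9 (by norm_num))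
        (hc 7 3 (by norm_num))).mul_left Z) (-2) 1 fun a b => ?_
      simp only [latticeEquiv, Equiv.coe_fn_mk, ← pow_mul, ← pow_add, ← pow_succ']
      congr 1
      rw [← Nat.cast_inj (R := ℚ)]
      push_cast [cast_tri]
      ring

/-- The analogue of `ramanujanTheta_sq_sub` for sums of two triangular numbers; since
`f(q, 1) = 2 ψ(q)`, it says `ψ(q) ^ 2 - q ψ(q ^ 5) ^ 2 = f(q, q ^ 4) f(q ^ 2, q ^ 3)`. -/
theorem ramanujanTheta_X_one_sq :
    ramanujanTheta X 1 ^ 2 = X * ramanujanTheta (X ^ 5) 1 ^ 2 +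
      4 * (ramanujanTheta X (X ^ 4) * ramanujanTheta (X ^ 2) (X ^ 3)) := by
  have hc : ∀ i j : ℕ, i ≠ 0 → constantCoeff ((X : ℤ⟦X⟧) ^ i * X ^ j) = 0 := by
    intro i j hi
    simp [hi]
  have hF := hasSum_ramanujanTheta_mul (hc 1 0 one_ne_zero) (hc 1 0 one_ne_zero)
  have e1 := ramanujanTheta_comm (hc 1 4 (by norm_num))
  have e2 := ramanujanTheta_comm (hc 2 3 (by norm_num))
  have h := eq_sum_of_hasSum_latticeEquiv hF 1
    ![X * (ramanujanTheta (X ^ 5) (X ^ 0) * ramanujanTheta (X ^ 5) (X ^ 0)),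
      ramanujanTheta (X ^ 2) (X ^ 3) * ramanujanTheta (X ^ 4) (X ^ 1),
      ramanujanTheta (X ^ 4) (X ^ 1) * ramanujanTheta (X ^ 3) (X ^ 2),
      ramanujanTheta (X ^ 1) (X ^ 4) * ramanujanTheta (X ^ 2) (X ^ 3),
      ramanujanTheta (X ^ 3) (X ^ 2) * ramanujanTheta (X ^ 1) (X ^ 4)] ?_
  · simp only [Fin.sum_univ_five, Matrix.cons_val, ← e1, ← e2] at h
    simp only [pow_one, pow_zero] at h
    linear_combination h
  · intro r
    fin_cases r
    · refine hasSum_of_hasSum_shift ((hasSum_ramanujanTheta_mul (hc 5 0 (by norm_num))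
        (hc 5 0 (by norm_num))).mul_left X) 0 0 fun a b => ?_
      simp only [latticeEquiv, Equiv.coe_fn_mk, ← pow_mul, ← pow_add, ← pow_succ']
      congr 1
      rw [← Nat.cast_inj (R := ℚ)]
      push_cast [cast_tri]
      ring
    · refine hasSum_of_hasSum_shift (hasSum_ramanujanTheta_mul (hc 2 3 (by norm_num))
        (hc 4 1 (by norm_num))) (-1) 0 fun a b => ?_
      simp only [latticeEquiv, Equiv.coe_fn_mk, ← pow_mul, ← pow_add]
      congr 1
      rw [← Nat.cast_inj (R := ℚ)]
      push_cast [cast_tri]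
      ring
    · refine hasSum_of_hasSum_shift (hasSum_ramanujanTheta_mul (hc 4 1 (by norm_num))
        (hc 3 2 (by norm_num))) (-1) 0 fun a b => ?_
      simp only [latticeEquiv, Equiv.coe_fn_mk, ← pow_mul, ← pow_add]
      congr 1
      rw [← Nat.cast_inj (R := ℚ)]
      push_cast [cast_tri]
      ring
    · refine hasSum_of_hasSum_shift (hasSum_ramanujanTheta_mul (hc 1 4 (by norm_num))
        (hc 2 3 (by norm_num))) (-2) 0 fun a b => ?_
      simp only [latticeEquiv, Equiv.coe_fn_mk, ← pow_mul, ← pow_add]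
      congr 1
      rw [← Nat.cast_inj (R := ℚ)]
      push_cast [cast_tri]
      ring
    · refine hasSum_of_hasSum_shift (hasSum_ramanujanTheta_mul (hc 3 2 (by norm_num))
        (hc 1 4 (by norm_num))) (-2) 0 fun a b => ?_
      simp only [latticeEquiv, Equiv.coe_fn_mk, ← pow_mul, ← pow_add]
      congr 1
      rw [← Nat.cast_inj (R := ℚ)]
      push_cast [cast_tri]
      ring

/-- Integers sorted by parity. -/
def intParityEquiv : Fin 2 × ℤ ≃ ℤ where
  toFun p := 2 * p.2 + (p.1 : ℕ)
  invFun n := (⟨(n % 2).toNat, by omega⟩, n / 2)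
  left_inv := by
    rintro ⟨⟨r, hr⟩, a⟩
    simp only [Prod.mk.injEq, Fin.mk.injEq]
    omega
  right_inv := by
    intro n
    simp only
    omega

theorem ramanujanTheta_self_eq {Z : ℤ⟦X⟧} (hZ : constantCoeff Z = 0) :
    ramanujanTheta Z Z = ramanujanTheta (Z ^ 4) (Z ^ 4) + Z * ramanujanTheta (Z ^ 8) 1 := by
  have hc : ∀ i j : ℕ, i ≠ 0 → constantCoeff (Z ^ i * Z ^ j) = 0 := by
    intro i j hi
    simp [hZ, hi]
  have hF := hasSum_ramanujanTheta (hc 1 1 one_ne_zero)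
  have h := (HasSum.prod_fiberwise (intParityEquiv.hasSum_iff.mpr hF)
    (g := ![ramanujanTheta (Z ^ 4) (Z ^ 4), Z * ramanujanTheta (Z ^ 8) (Z ^ 0)]) ?_).unique
    (hasSum_fintype _)
  · simpa using h
  · intro r
    fin_cases r
    · refine (hasSum_ramanujanTheta (hc 4 4 (by norm_num))).congr_fun fun a => ?_
      simp only [intParityEquiv, Function.comp_apply, Equiv.coe_fn_mk, ← pow_mul, ← pow_add]
      congr 1
      rw [← Nat.cast_inj (R := ℚ)]
      push_cast [cast_tri]
      ring
    · refine ((hasSum_ramanujanTheta (hc 8 0 (by norm_num))).mul_left Z).congr_fun fun a => ?_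
      simp only [intParityEquiv, Function.comp_apply, Equiv.coe_fn_mk, ← pow_mul, ← pow_add,
        ← pow_succ']
      congr 1
      rw [← Nat.cast_inj (R := ℚ)]
      push_cast [cast_tri]
      ring

/-! ### Eta quotients for the theta functions and two identities of level 10 -/

/-- The Euler product `E_k = ∏ (1 - X ^ (k n))` over `n ≥ 1`. -/
noncomputable def eulerProd (k : ℕ) : ℤ⟦X⟧ := qProd (X ^ k) (X ^ k)

/-- The theta function `φ(q) = ∑ q ^ (n ^ 2)` over all integers `n`. -/
noncomputable def phi : ℤ⟦X⟧ := ramanujanTheta X X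

/-- The theta function `φ(-q) = ∑ (-q) ^ (n ^ 2)` over all integers `n`. -/
noncomputable def phiNeg : ℤ⟦X⟧ := ramanujanTheta (-X) (-X)

/-- The theta function `ψ(q) = ∑ q ^ (n (n + 1) / 2)` over `n ≥ 0`, in its product form
`∏ (1 + q ^ n) ^ 2 (1 - q ^ n)`; half of the bilateral series by `ramanujanTheta_X_one`. -/
noncomputable def psi : ℤ⟦X⟧ := qProd (-X) X ^ 2 * eulerProd 1

theorem constantCoeff_eulerProd {k : ℕ} (hk : k ≠ 0) : constantCoeff (eulerProd k) = 1 :=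
  constantCoeff_qProd (by simp [hk]) (by simp [hk])

theorem eulerProd_ne_zero {k : ℕ} (hk : k ≠ 0) : eulerProd k ≠ 0 :=
  (isUnit_of_constantCoeff_eq_one (constantCoeff_eulerProd hk)).ne_zero

theorem expand_eulerProd {d k : ℕ} (hd : d ≠ 0) (hk : k ≠ 0) :
    expand d hd (eulerProd k) = eulerProd (d * k) := by
  rw [eulerProd, expand_qProd hd _ (by simp [hk])]
  simp [eulerProd, pow_mul]

theorem eulerProd_mul_qProd_neg {k : ℕ} (hk : k ≠ 0) :
    eulerProd k * qProd (-X ^ k) (X ^ k) = eulerProd (2 * k) := by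
  rw [eulerProd, qProd_mul_qProd_neg _ (by simp [hk]), ← pow_mul, eulerProd, mul_comm k]

theorem qProd_sq_mul_eulerProd {k : ℕ} (hk : k ≠ 0) :
    qProd (X ^ k) (X ^ (2 * k)) * eulerProd (2 * k) = eulerProd k := by
  rw [eulerProd, eulerProd, qProd_eq_prod_qProd_pow (X ^ k) (Q := X ^ k) (by simp [hk]) two_ne_zero]
  simp only [Finset.prod_range_succ, Finset.prod_range_zero]
  ring_nf

theorem phiNeg_mul_eulerProd : phiNeg * eulerProd 2 = eulerProd 1 ^ 2 := by
  have h := qProd_sq_mul_eulerProd one_ne_zero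
  rw [phiNeg, ramanujanTheta_eq (by simp) (by simp) (by simp)]
  rw [← h, show (-X : ℤ⟦X⟧) * -X = X ^ 2 by ring]
  simp only [neg_neg, eulerProd, mul_one, pow_one]
  ring

theorem phi_mul_eulerProd : phi * (eulerProd 1 ^ 2 * eulerProd 4 ^ 2) = eulerProd 2 ^ 5 := by
  have h1 := qProd_sq_mul_eulerProd one_ne_zero
  have h2 := qProd_sq_mul_eulerProd two_ne_zero
  have h3 := qProd_mul_qProd_neg X (Q := X ^ 2) (by simp)
  rw [phi, ramanujanTheta_eq (by simp) (by simp) (by simp)]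
  rw [show (X : ℤ⟦X⟧) * X = X ^ 2 by ring, ← h1]
  rw [← pow_mul] at h3
  simp only [mul_one, pow_one, Nat.reduceMul] at h2 ⊢
  rw [← h3] at h2
  have h4 : eulerProd 2 = qProd (X ^ 2) (X ^ 2) := rfl
  rw [← h4]
  linear_combination eulerProd 2 ^ 3 * (qProd X (X ^ 2) * qProd (-X) (X ^ 2) * eulerProd 4 +
    eulerProd 2) * h2

theorem psi_mul_eulerProd : psi * eulerProd 1 = eulerProd 2 ^ 2 := by
  have h := eulerProd_mul_qProd_neg one_ne_zero
  rw [mul_one, pow_one] at h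
  rw [psi, ← h]
  ring

theorem ramanujanTheta_X_one : ramanujanTheta X 1 = 2 * psi := by
  rw [ramanujanTheta_eq (by simp) (by simp) (by simp), mul_one,
    qProd_eq_one_sub_mul (-1) (by simp), psi, eulerProd, pow_one, neg_one_mul]
  ring

theorem ramanujanTheta_X_pow_one {k : ℕ} (hk : k ≠ 0) :
    ramanujanTheta (X ^ k) 1 = 2 * expand k hk psi := by
  have h := expand_ramanujanTheta hk (a := X) (b := 1) (by simp)
  rw [ramanujanTheta_X_one, map_mul, map_ofNat, map_one, expand_X] at h
  exact h.symm

theorem psi_sq_eq : psi ^ 2 = X * expand 5 (by norm_num) psi ^ 2 +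
    ramanujanTheta X (X ^ 4) * ramanujanTheta (X ^ 2) (X ^ 3) := by
  have h := ramanujanTheta_X_one_sq
  rw [ramanujanTheta_X_one, ramanujanTheta_X_pow_one (by norm_num)] at h
  have h4 : (4 : ℤ⟦X⟧) ≠ 0 := fun h0 => by
    have h1 := congrArg constantCoeff h0
    rw [map_ofNat, map_zero] at h1
    norm_num at h1
  apply mul_left_cancel₀ h4
  linear_combination h

theorem ramanujanTheta_mul_eq_etaQuotient_five :
    ramanujanTheta X (X ^ 4) * ramanujanTheta (X ^ 2) (X ^ 3) * (eulerProd 1 * eulerProd 10) =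
      eulerProd 2 * eulerProd 5 ^ 3 := by
  have h1 := eulerProd_mul_qProd_neg one_ne_zero
  have h2 := eulerProd_mul_qProd_neg (k := 5) (by norm_num)
  have h3 := qProd_eq_prod_qProd_pow (-X) (Q := X) (by simp) (d := 5) (by norm_num)
  rw [ramanujanTheta_eq (by simp) (by simp) (by simp),
    ramanujanTheta_eq (by simp) (by simp) (by simp)]
  simp only [Finset.prod_range_succ, Finset.prod_range_zero, neg_mul, ← pow_succ', ← pow_add,
    Nat.reduceAdd, pow_one, one_mul, Nat.reduceMul] at h1 h2 h3 ⊢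
  rw [← h1, ← h2, h3]
  simp only [eulerProd]
  ring

theorem phiNeg_sq_eq : phiNeg ^ 2 = expand 5 (by norm_num) phiNeg ^ 2 -
    4 * X * (ramanujanTheta (-X) ((-X) ^ 9) * ramanujanTheta ((-X) ^ 3) ((-X) ^ 7)) := by
  have h := ramanujanTheta_sq_sub (Z := -X) (by simp)
  have h2 := expand_ramanujanTheta (d := 5) (by norm_num) (a := -X) (b := -X) (by simp)
  rw [map_neg, expand_X, show -(X : ℤ⟦X⟧) ^ 5 = (-X) ^ 5 by ring] at h2
  rw [← h2] at h
  rw [phiNeg, h]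
  ring

theorem ramanujanTheta_mul_eq_etaQuotient_ten :
    ramanujanTheta (-X) ((-X) ^ 9) * ramanujanTheta ((-X) ^ 3) ((-X) ^ 7) *
      (eulerProd 2 * eulerProd 5) = eulerProd 1 * eulerProd 10 ^ 3 := by
  have h1 := qProd_sq_mul_eulerProd one_ne_zero
  have h2 := qProd_sq_mul_eulerProd (k := 5) (by norm_num)
  have h3 := qProd_eq_prod_qProd_pow X (Q := X ^ 2) (by simp) (d := 5) (by norm_num)
  rw [ramanujanTheta_eq (by simp) (by simp) (by simp),
    ramanujanTheta_eq (by simp) (by simp) (by simp)]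
  have e9 : (-X : ℤ⟦X⟧) ^ 9 = -X ^ 9 := by ring
  have e3 : (-X : ℤ⟦X⟧) ^ 3 = -X ^ 3 := by ring
  have e7 : (-X : ℤ⟦X⟧) ^ 7 = -X ^ 7 := by ring
  simp only [e9, e3, e7, Finset.prod_range_succ, Finset.prod_range_zero, neg_mul_neg, neg_neg,
    ← pow_mul, ← pow_succ', ← pow_add,
    Nat.reduceAdd, pow_one, one_mul, Nat.reduceMul] at h1 h2 h3 ⊢
  rw [← h1, ← h2, h3]
  simp only [eulerProd]
  ring

theorem phi_eq : phi = expand 4 (by norm_num) phi + 2 * X * expand 8 (by norm_num) psi := by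
  have h := ramanujanTheta_self_eq (Z := X) (by simp)
  have h2 := expand_ramanujanTheta (d := 4) (by norm_num) (a := X) (b := X) (by simp)
  rw [expand_X] at h2
  rw [ramanujanTheta_X_pow_one (by norm_num), ← h2] at h
  rw [phi]
  linear_combination h

theorem phiNeg_eq : phiNeg = expand 4 (by norm_num) phi - 2 * X * expand 8 (by norm_num) psi := by
  have h := ramanujanTheta_self_eq (Z := -X) (by simp)
  have h2 := expand_ramanujanTheta (d := 4) (by norm_num) (a := X) (b := X) (by simp)
  rw [expand_X] at h2
  rw [show (-X : ℤ⟦X⟧) ^ 8 = X ^ 8 by ring, show (-X : ℤ⟦X⟧) ^ 4 = X ^ 4 by ring,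
    ramanujanTheta_X_pow_one (by norm_num), ← h2] at h
  rw [phiNeg, phi]
  linear_combination h

/-! ### Frobenius modulo 5 and the fixed points of `q ↦ q ^ 2` -/

/-- The Frobenius endomorphism on power series over the prime field. -/
theorem expand_eq_pow_prime {p : ℕ} [hp : Fact p.Prime] (f : (ZMod p)⟦X⟧) :
    expand p hp.out.ne_zero f = f ^ p := by
  ext n
  obtain ⟨g, hg⟩ : (X : (ZMod p)⟦X⟧) ^ (n + 1) ∣ f - (trunc (n + 1) f : Polynomial (ZMod p)) := by
    rw [X_pow_dvd_iff]
    intro m hm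
    rw [map_sub, Polynomial.coeff_coe, coeff_trunc, if_pos hm, sub_self]
  rw [sub_eq_iff_eq_add] at hg
  have : CharP (ZMod p)⟦X⟧ p := charP_of_injective_algebraMap (R := ZMod p) C_injective p
  rw [hg, add_pow_char, map_add, map_add, map_add, ← Polynomial.coe_pow, ← ZMod.expand_card,
    Polynomial.coeff_coe, Polynomial.coeff_expand hp.out.pos, coeff_expand, coeff_expand,
    Polynomial.coeff_coe]
  congr 1
  have h1 : ∀ m ≤ n, coeff m (X ^ (n + 1) * g) = 0 := fun m hm =>
    X_pow_dvd_iff.mp (dvd_mul_right _ _) m (by omega)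
  have h2 : coeff n ((X ^ (n + 1) * g) ^ p) = 0 :=
    X_pow_dvd_iff.mp ((dvd_mul_right _ g).trans (dvd_pow_self _ hp.out.ne_zero)) n (by omega)
  rw [h2]
  split_ifs
  · exact h1 _ (Nat.div_le_self _ _)
  · rfl

theorem exists_eq_natCast_mul_of_map_eq_zero {n : ℕ} {f : ℤ⟦X⟧}
    (h : map (Int.castRingHom (ZMod n)) f = 0) : ∃ g : ℤ⟦X⟧, f = n * g := by
  have h1 : ∀ m, (n : ℤ) ∣ coeff m f := fun m => by
    rw [← ZMod.intCast_zmod_eq_zero_iff_dvd, ← eq_intCast (Int.castRingHom (ZMod n)), ← coeff_map,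
      h, map_zero]
  choose g hg using h1
  refine ⟨mk g, ?_⟩
  ext m
  rw [hg m, ← map_natCast (C (R := ℤ)), coeff_C_mul, coeff_mk]

theorem exists_pow_five_eq (f : ℤ⟦X⟧) : ∃ g, f ^ 5 = expand 5 (by norm_num) f + 5 * g := by
  have : Fact (Nat.Prime 5) := ⟨by norm_num⟩
  obtain ⟨g, hg⟩ := exists_eq_natCast_mul_of_map_eq_zero (n := 5)
    (f := f ^ 5 - expand 5 (by norm_num) f) (by
      rw [map_sub, map_pow, map_expand, ← expand_eq_pow_prime, sub_self])
  exact ⟨g, by linear_combination hg⟩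

theorem exists_eulerProd_pow_five : ∃ s : ℤ⟦X⟧, constantCoeff s = 0 ∧
    eulerProd 1 ^ 5 = eulerProd 5 * (1 - 5 * s) := by
  obtain ⟨g, hg⟩ := exists_pow_five_eq (eulerProd 1)
  rw [expand_eulerProd _ one_ne_zero, mul_one] at hg
  have h5 := constantCoeff_eulerProd (k := 5) (by norm_num)
  obtain ⟨w, hw⟩ := isUnit_iff_exists_inv.mp (isUnit_of_constantCoeff_eq_one h5)
  refine ⟨-(g * w), ?_, by linear_combination hg - 5 * g * hw⟩
  have h := congrArg constantCoeff hg
  rw [map_pow, map_add, map_mul, constantCoeff_eulerProd one_ne_zero, h5, map_ofNat] at h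
  rw [map_neg, map_mul]
  have : constantCoeff g = 0 := by linarith
  rw [this]; simp

/-- A series that `q ↦ q ^ 2` fixes up to a constant factor has no term of positive degree. -/
theorem eq_zero_of_eq_mul_expand {R : Type*} [CommRing R] {f : R⟦X⟧} {u : R}
    (h : f = C u * expand 2 two_ne_zero f) (h0 : constantCoeff f = 0) : f = 0 := by
  ext n
  induction n using Nat.strong_induction_on with
  | _ n ih =>
    rcases Nat.eq_zero_or_pos n with rfl | hn
    · simpa using h0
    · rw [h, coeff_C_mul, coeff_expand]
      split_ifs
      · rw [ih (n / 2) (by omega)]; simp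
      · simp

/-- Dividing by `E_2 ^ 5 E_5 ^ 2` this reads
`E_1 ^ 5 E_10 / (E_2 ^ 5 E_5) = 1 - 5 q ψ(q ^ 5) ^ 2 / ψ(q) ^ 2`. It is the difference of the two
identities that come from sublattices of index `5`. -/
theorem eulerProd_pow_five_sub :
    eulerProd 1 ^ 5 * eulerProd 5 * eulerProd 10 =
      eulerProd 2 ^ 5 * eulerProd 5 ^ 2 - 5 * X * eulerProd 1 ^ 2 * eulerProd 2 * eulerProd 10 ^ 4
      := by
  have h5 : (5 : ℕ) ≠ 0 := by norm_num
  have hA := psi_mul_eulerProd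
  have hA5 := congrArg (expand 5 h5) psi_mul_eulerProd
  have hc := phiNeg_mul_eulerProd
  have hc5 := congrArg (expand 5 h5) phiNeg_mul_eulerProd
  simp only [map_mul, map_pow, expand_eulerProd h5 one_ne_zero, expand_eulerProd h5 two_ne_zero,
    Nat.reduceMul] at hA5 hc5
  have hI := psi_sq_eq
  have hJ := ramanujanTheta_mul_eq_etaQuotient_five
  have hK := phiNeg_sq_eq
  have hL := ramanujanTheta_mul_eq_etaQuotient_ten
  have n10 := eulerProd_ne_zero (k := 10) (by norm_num)
  generalize ramanujanTheta X (X ^ 4) * ramanujanTheta (X ^ 2) (X ^ 3) = F at *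
  generalize ramanujanTheta (-X) ((-X) ^ 9) * ramanujanTheta ((-X) ^ 3) ((-X) ^ 7) = G at *
  generalize eulerProd 1 = e1 at *
  generalize eulerProd 2 = e2 at *
  generalize eulerProd 5 = f1 at *
  generalize eulerProd 10 = f2 at *
  generalize expand 5 _ psi = p5 at *
  generalize expand 5 _ phiNeg = c5 at *
  generalize psi = p at *
  generalize phiNeg = c at *
  -- the two lattice identities, with denominators cleared
  have H1 : e2 ^ 4 * f1 ^ 2 * f2 = X * f2 ^ 5 * e1 ^ 2 + e1 * e2 * f1 ^ 5 := by
    have q1 : (p * e1) ^ 2 = (e2 ^ 2) ^ 2 := by rw [hA]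
    have q2 : (p5 * f1) ^ 2 = (f2 ^ 2) ^ 2 := by rw [hA5]
    linear_combination (-f1 ^ 2 * f2) * q1 + (X * e1 ^ 2 * f2) * q2 +
      (e1 ^ 2 * f1 ^ 2 * f2) * hI + (e1 * f1 ^ 2) * hJ
  have H2 : e1 ^ 4 * f2 ^ 2 * f1 = f1 ^ 5 * e2 ^ 2 - 4 * X * e1 * e2 * f2 ^ 5 := by
    have q1 : (c * e2) ^ 2 = (e1 ^ 2) ^ 2 := by rw [hc]
    have q2 : (c5 * f2) ^ 2 = (f1 ^ 2) ^ 2 := by rw [hc5]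
    linear_combination (-f1 * f2 ^ 2) * q1 + (e2 ^ 2 * f1) * q2 + (e2 ^ 2 * f2 ^ 2 * f1) * hK -
      4 * X * e2 * f2 ^ 2 * hL
  apply mul_left_cancel₀ n10
  linear_combination e1 * H2 - e2 * H1

/-! ### Identities between `φ(q)`, `φ(-q)` and `ψ(q)`, and 4-dissections -/

theorem phi_mul_expand_psi : phi * expand 2 two_ne_zero psi = psi ^ 2 := by
  have h1 := phi_mul_eulerProd
  have h2 := psi_mul_eulerProd
  have h3 := congrArg (expand 2 two_ne_zero) psi_mul_eulerProd
  simp only [map_mul, map_pow, expand_eulerProd two_ne_zero one_ne_zero,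
    expand_eulerProd two_ne_zero two_ne_zero, Nat.reduceMul] at h3
  have n1 := eulerProd_ne_zero one_ne_zero
  have n2 := eulerProd_ne_zero two_ne_zero
  have n4 := eulerProd_ne_zero (k := 4) (by norm_num)
  apply mul_left_cancel₀ (mul_ne_zero (mul_ne_zero (pow_ne_zero 2 n1) (pow_ne_zero 2 n4)) n2)
  linear_combination expand 2 two_ne_zero psi * eulerProd 2 * h1 + eulerProd 2 ^ 5 * h3 -
    eulerProd 4 ^ 2 * eulerProd 2 * (psi * eulerProd 1 + eulerProd 2 ^ 2) * h2

theorem expand_expand_two (f : ℤ⟦X⟧) :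
    expand 2 two_ne_zero (expand 2 two_ne_zero f) = expand 4 four_ne_zero f :=
  (expand_mul 2 two_ne_zero 2 two_ne_zero f).symm

theorem expand_four_expand_two (f : ℤ⟦X⟧) :
    expand 4 four_ne_zero (expand 2 two_ne_zero f) = expand 8 (by norm_num) f :=
  (expand_mul 4 four_ne_zero 2 two_ne_zero f).symm

theorem expand_two_expand_four (f : ℤ⟦X⟧) :
    expand 2 two_ne_zero (expand 4 four_ne_zero f) = expand 8 (by norm_num) f :=
  (expand_mul 2 two_ne_zero 4 four_ne_zero f).symm

theorem constantCoeff_phi : constantCoeff phi = 1 := by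
  have h := congrArg constantCoeff phi_mul_eulerProd
  simpa [constantCoeff_eulerProd] using h

/-- The difference `d` of the two sides satisfies `d(q) = -d(q ^ 2)`. -/
theorem phi_sq_eq : phi ^ 2 = expand 2 two_ne_zero phi ^ 2 +
    4 * X * expand 4 four_ne_zero psi ^ 2 := by
  have h1 := phi_eq
  have h2 := congrArg (expand 4 four_ne_zero) phi_mul_expand_psi
  rw [map_mul, map_pow, expand_four_expand_two] at h2
  rw [← sub_eq_zero]
  refine eq_zero_of_eq_mul_expand (u := -1) ?_ ?_
  · simp only [map_sub, map_add, map_mul, map_pow, map_ofNat, expand_X, expand_expand_two,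
      expand_two_expand_four, map_neg, map_one]
    linear_combination (phi + expand 4 four_ne_zero phi + 2 * X * expand 8 (by norm_num) psi) * h1 +
      4 * X * h2
  · simp [constantCoeff_phi]

theorem phiNeg_sq_eq_expand_two : phiNeg ^ 2 = expand 2 two_ne_zero phi ^ 2 -
    4 * X * expand 4 four_ne_zero psi ^ 2 := by
  have h1 := phi_eq
  have h2 := phiNeg_eq
  have h3 := congrArg (expand 4 four_ne_zero) phi_mul_expand_psi
  rw [map_mul, map_pow, expand_four_expand_two] at h3
  have h4 := phi_sq_eq
  linear_combination h4 - 8 * X * h3 + (phiNeg + expand 4 four_ne_zero phi -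
    2 * X * expand 8 (by norm_num) psi) * h2 - (phi + expand 4 four_ne_zero phi +
    2 * X * expand 8 (by norm_num) psi) * h1

theorem phiNeg_pow_four_eq :
    phiNeg ^ 4 = phi ^ 4 - 16 * X * expand 2 two_ne_zero psi ^ 4 := by
  have h1 := phi_sq_eq
  have h2 := phiNeg_sq_eq_expand_two
  have h3 := congrArg (expand 2 two_ne_zero) phi_mul_expand_psi
  rw [map_mul, map_pow, expand_expand_two] at h3
  linear_combination (phiNeg ^ 2 + expand 2 two_ne_zero phi ^ 2 -
    4 * X * expand 4 four_ne_zero psi ^ 2) * h2 - (phi ^ 2 + expand 2 two_ne_zero phi ^ 2 +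
    4 * X * expand 4 four_ne_zero psi ^ 2) * h1 - 16 * X * (expand 2 two_ne_zero phi *
    expand 4 four_ne_zero psi + expand 2 two_ne_zero psi ^ 2) * h3

/-- With `u` and `v` the fourth powers of the theta constants `θ₃` and `θ₂`, both sides are the weight
four Eisenstein series of level one at the same argument. -/
theorem expand_two_eisenstein {u v : ℤ⟦X⟧} (hu : u = phi ^ 4)
    (hv : v = 16 * X * expand 2 two_ne_zero psi ^ 4) :
    expand 2 two_ne_zero (u ^ 2 + 14 * u * v + v ^ 2) = u ^ 2 - u * v + v ^ 2 := by
  have h1 := phi_sq_eq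
  have h2 := phiNeg_sq_eq_expand_two
  have h3 := phiNeg_pow_four_eq
  have hu' : u = (expand 2 two_ne_zero phi ^ 2 + 4 * X * expand 4 four_ne_zero psi ^ 2) ^ 2 := by
    rw [hu, ← h1]; ring
  have hv' : v = 16 * X * expand 2 two_ne_zero phi ^ 2 * expand 4 four_ne_zero psi ^ 2 := by
    have : v = phi ^ 4 - phiNeg ^ 4 := by rw [h3, hv]; ring
    rw [this, show phi ^ 4 = (phi ^ 2) ^ 2 by ring, show phiNeg ^ 4 = (phiNeg ^ 2) ^ 2 by ring, h1,
      h2]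
    ring
  conv_lhs => rw [hu, hv]
  simp only [map_add, map_mul, map_pow, map_ofNat, expand_X, expand_expand_two]
  rw [hu', hv']
  ring

theorem coeff_X_pow_mul_expand {R : Type*} [CommRing R] {m : ℕ} (hm : m ≠ 0) (A : R⟦X⟧) {k r : ℕ}
    (hk : k < m) (hr : r < m) (n : ℕ) :
    coeff (m * n + r) (X ^ k * expand m hm A) = if k = r then coeff n A else 0 := by
  rw [coeff_X_pow_mul', coeff_expand]
  by_cases h : k = r
  · rw [if_pos h, h, if_pos (by omega), Nat.add_sub_cancel, if_pos (dvd_mul_right _ _),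
      Nat.mul_div_cancel_left _ (Nat.pos_of_ne_zero hm)]
  · rw [if_neg h]
    split_ifs with h1 h2
    · exfalso
      have h3 : m * n + r ≡ k [MOD m] := ((Nat.modEq_iff_dvd' h1).mpr h2).symm
      have h4 : r % m = k % m := by simpa [Nat.ModEq] using h3
      rw [Nat.mod_eq_of_lt hk, Nat.mod_eq_of_lt hr] at h4
      exact h h4.symm
    · rfl
    · rfl

/-- Coefficients of a series given by its sections modulo `4`. -/
theorem coeff_dissection {R : Type*} [CommRing R] {f A B C D : R⟦X⟧}
    (h : f = expand 4 four_ne_zero A + X * expand 4 four_ne_zero B +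
      X ^ 2 * expand 4 four_ne_zero C + X ^ 3 * expand 4 four_ne_zero D) (n : ℕ) :
    coeff (4 * n) f = coeff n A ∧ coeff (4 * n + 1) f = coeff n B ∧
      coeff (4 * n + 2) f = coeff n C := by
  have h1 : f = X ^ 0 * expand 4 four_ne_zero A + X ^ 1 * expand 4 four_ne_zero B +
      X ^ 2 * expand 4 four_ne_zero C + X ^ 3 * expand 4 four_ne_zero D := by
    rw [h]; ring
  have key : ∀ r < 4, coeff (4 * n + r) f = (if 0 = r then coeff n A else 0) +
      (if 1 = r then coeff n B else 0) + (if 2 = r then coeff n C else 0) +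
      (if 3 = r then coeff n D else 0) := fun r hr => by
    rw [h1]
    simp only [map_add]
    rw [coeff_X_pow_mul_expand _ _ (by norm_num) hr, coeff_X_pow_mul_expand _ _ (by norm_num) hr,
      coeff_X_pow_mul_expand _ _ (by norm_num) hr, coeff_X_pow_mul_expand _ _ (by norm_num) hr]
  refine ⟨?_, ?_, ?_⟩
  · simpa using key 0 (by norm_num)
  · simpa using key 1 (by norm_num)
  · simpa using key 2 (by norm_num)

/-! ### The generating function of overpartitions and its sections modulo 16 -/

theorem overpartitionCount_eq_sum (n : ℕ) :
    overpartitionCount n = ∑ p : n.Partition, 2 ^ p.parts.toFinset.card := by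
  rw [overpartitionCount, Fintype.card_sigma]
  refine Finset.sum_congr rfl fun p _ => ?_
  rw [Fintype.card_coe, Finset.card_powerset]

theorem genFun_two_eq :
    (Nat.Partition.genFun fun _ _ => (2 : ℤ)) = mk fun n => (overpartitionCount n : ℤ) := by
  ext n
  rw [Nat.Partition.coeff_genFun, coeff_mk, overpartitionCount_eq_sum, Nat.cast_sum]
  refine Finset.sum_congr rfl fun p _ => ?_
  simp [Finsupp.prod]

theorem overpartitionSeries_mul_qProd :
    (mk fun n => (overpartitionCount n : ℤ)) * qProd X X = qProd (-X) X := by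
  rw [← genFun_two_eq]
  have h := (Nat.Partition.hasProd_genFun fun _ _ => (2 : ℤ)).mul
    (hasProd_qProd X (Q := X) (by simp))
  refine h.unique ?_
  refine (hasProd_qProd (-X) (Q := X) (by simp)).congr_fun fun i => ?_
  have hY : constantCoeff ((X : ℤ⟦X⟧) ^ (i + 1)) = 0 := by simp
  have hT := WithPiTopology.tsum_pow_mul_one_sub_of_constantCoeff_eq_zero hY
  have hS := WithPiTopology.summable_pow_of_constantCoeff_eq_zero hY
  have h2 : ∑' j : ℕ, C (2 : ℤ) * (X : ℤ⟦X⟧) ^ ((i + 1) * (j + 1)) =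
      2 * X ^ (i + 1) * ∑' j : ℕ, (X ^ (i + 1)) ^ j := by
    rw [← hS.tsum_mul_left]
    refine tsum_congr fun j => ?_
    rw [map_ofNat]
    ring
  simp only [smul_eq_C_mul]
  rw [h2]
  linear_combination 2 * X ^ (i + 1) * hT

theorem overpartitionSeries_mul_phiNeg :
    (mk fun n => (overpartitionCount n : ℤ)) * phiNeg = 1 := by
  have h1 := overpartitionSeries_mul_qProd
  have h2 := eulerProd_mul_qProd_neg one_ne_zero
  have h3 := phiNeg_mul_eulerProd
  have h4 : eulerProd 1 = qProd X X := by rw [eulerProd, pow_one]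
  rw [mul_one, pow_one, ← h1, ← h4] at h2
  have n2 := eulerProd_ne_zero two_ne_zero
  apply mul_left_cancel₀ n2
  linear_combination (mk fun n => (overpartitionCount n : ℤ)) * h3 + h2

theorem isUnit_phiNeg : IsUnit phiNeg :=
  IsUnit.of_mul_eq_one_right _ overpartitionSeries_mul_phiNeg

/-- The generating function of `overpartitionCount (4 * n)` is `φ(q) ^ 3 / φ(-q) ^ 4`. -/
theorem exists_series_four_mul : ∃ G : ℤ⟦X⟧, G * phiNeg ^ 4 = phi ^ 3 ∧
    ∀ n, coeff n G = overpartitionCount (4 * n) := by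
  have h1 := phiNeg_eq
  have h2 := congrArg (expand 4 four_ne_zero) phiNeg_pow_four_eq
  have h3 := overpartitionSeries_mul_phiNeg
  obtain ⟨w, hw⟩ := isUnit_iff_exists_inv.mp (isUnit_phiNeg.pow 4)
  have h4 := congrArg (expand 4 four_ne_zero) hw
  simp only [map_mul, map_pow, map_sub, map_ofNat, map_one, expand_X,
    expand_four_expand_two] at h2 h4
  set b := expand 2 two_ne_zero psi with hb
  have hb4 : expand 4 four_ne_zero b = expand 8 (by norm_num) psi := expand_four_expand_two _
  refine ⟨w * phi ^ 3, by linear_combination phi ^ 3 * hw, fun n => ?_⟩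
  have key := (coeff_dissection (f := mk fun n => (overpartitionCount n : ℤ)) (A := w * phi ^ 3)
    (B := w * (2 * phi ^ 2 * b)) (C := w * (4 * phi * b ^ 2)) (D := w * (8 * b ^ 3)) ?_ n).1
  · rw [← key, coeff_mk]
  · simp only [map_mul, map_pow, map_ofNat, hb4]
    generalize (mk fun n => (overpartitionCount n : ℤ)) = P at *
    generalize expand 8 _ psi = p8 at *
    generalize expand 4 _ phi = x at *
    generalize expand 4 _ phiNeg = c4 at *
    generalize expand 4 _ w = w4 at *
    rw [h2] at h4
    rw [h1] at h3
    linear_combination (-P) * h4 + w4 * (x ^ 3 + 2 * X * x ^ 2 * p8 + 4 * X ^ 2 * x * p8 ^ 2 +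
      8 * X ^ 3 * p8 ^ 3) * h3

/-- The sections of `φ(q) ^ 3 / φ(-q) ^ 4` along `1` and `2` modulo `4`: the numerators collect the terms
of `(x + y) ^ 7 (x ^ 2 + y ^ 2) ^ 4` of degree `1` modulo `4`, respectively of degree `2` modulo
`4`, in `y`, where `φ(±q) = x ± y`. -/
theorem exists_series_sixteen_mul {v b : ℤ⟦X⟧} (hb : b = expand 2 two_ne_zero psi)
    (hv : v = 16 * X * b ^ 4) : ∃ G H : ℤ⟦X⟧,
    G * phiNeg ^ 16 = 2 * b * (7 * phi ^ 14 + 203 * phi ^ 10 * v + 277 * phi ^ 6 * v ^ 2 +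
      25 * phi ^ 2 * v ^ 3) ∧
    H * phiNeg ^ 16 = 4 * b ^ 2 * (25 * phi ^ 13 + 277 * phi ^ 9 * v + 203 * phi ^ 5 * v ^ 2 +
      7 * phi * v ^ 3) ∧
    (∀ n, coeff n G = overpartitionCount (16 * n + 4)) ∧
    ∀ n, coeff n H = overpartitionCount (16 * n + 8) := by
  obtain ⟨F, hF, hFc⟩ := exists_series_four_mul
  have h0 := phi_eq
  have h1 := phiNeg_eq
  have h2 := congrArg (expand 4 four_ne_zero) phiNeg_pow_four_eq
  rw [← hb] at h2
  obtain ⟨w, hw⟩ := isUnit_iff_exists_inv.mp (isUnit_phiNeg.pow 16)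
  have h4 := congrArg (expand 4 four_ne_zero) hw
  have hb4 : expand 4 four_ne_zero b = expand 8 (by norm_num) psi := by
    rw [hb]; exact expand_four_expand_two _
  simp only [map_mul, map_pow, map_sub, map_ofNat, map_one, expand_X, hb4] at h2 h4
  have key := coeff_dissection (f := F)
    (A := w * (phi ^ 15 + 125 * phi ^ 11 * v + 323 * phi ^ 7 * v ^ 2 + 63 * phi ^ 3 * v ^ 3))
    (B := w * (2 * b * (7 * phi ^ 14 + 203 * phi ^ 10 * v + 277 * phi ^ 6 * v ^ 2 +
      25 * phi ^ 2 * v ^ 3)))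
    (C := w * (4 * b ^ 2 * (25 * phi ^ 13 + 277 * phi ^ 9 * v + 203 * phi ^ 5 * v ^ 2 +
      7 * phi * v ^ 3)))
    (D := w * (8 * b ^ 3 * (63 * phi ^ 12 + 323 * phi ^ 8 * v + 125 * phi ^ 4 * v ^ 2 +
      v ^ 3))) ?_
  · refine ⟨w * (2 * b * (7 * phi ^ 14 + 203 * phi ^ 10 * v + 277 * phi ^ 6 * v ^ 2 +
        25 * phi ^ 2 * v ^ 3)), w * (4 * b ^ 2 * (25 * phi ^ 13 + 277 * phi ^ 9 * v +
        203 * phi ^ 5 * v ^ 2 + 7 * phi * v ^ 3)), ?_, ?_, fun n => ?_, fun n => ?_⟩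
    · linear_combination (2 * b * (7 * phi ^ 14 + 203 * phi ^ 10 * v + 277 * phi ^ 6 * v ^ 2 +
        25 * phi ^ 2 * v ^ 3)) * hw
    · linear_combination (4 * b ^ 2 * (25 * phi ^ 13 + 277 * phi ^ 9 * v + 203 * phi ^ 5 * v ^ 2 +
        7 * phi * v ^ 3)) * hw
    · rw [← (key n).2.1, hFc, show 4 * (4 * n + 1) = 16 * n + 4 by ring]
    · rw [← (key n).2.2, hFc, show 4 * (4 * n + 2) = 16 * n + 8 by ring]
  · simp only [hv, map_mul, map_pow, map_ofNat, map_add, hb4, expand_X]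
    rw [show expand 4 four_ne_zero phiNeg ^ 16 = (expand 4 four_ne_zero phiNeg ^ 4) ^ 4 by ring,
      h2] at h4
    rw [h0, h1] at hF
    generalize expand 8 _ psi = p8 at *
    generalize expand 4 _ phi = x at *
    generalize expand 4 _ phiNeg = c4 at *
    generalize expand 4 _ w = w4 at *
    linear_combination (-F) * h4 + w4 * (x + 2 * X * p8) ^ 4 * (x ^ 2 + 4 * X ^ 2 * p8 ^ 2) ^ 4 * hF

/-! ### Evaluation of the sections modulo 25 -/

/-- Generalized pentagonal numbers are congruent to `0`, `1` or `2` modulo `5`. -/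
theorem coeff_eulerProd_eq_zero {n : ℕ} (hn : n % 5 = 3 ∨ n % 5 = 4) :
    coeff n (eulerProd 1) = 0 := by
  have h : eulerProd 1 = pentagonalSeries ℤ := by
    rw [← WithPiTopology.tprod_one_sub_X_pow, eulerProd, pow_one, qProd]
    exact tprod_congr fun k => by rw [pow_succ']
  rw [h]
  refine coeff_pentagonalSeries_eq_zero ℤ ?_
  rintro ⟨k, hk⟩
  have h2 := two_mul_natCast_pentagonal k
  rw [hk] at h2
  have h3 : (2 * (n : ℤ)) % 5 = (k * (3 * k - 1)) % 5 := by rw [h2]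
  rw [Int.mul_emod k] at h3
  have h4 : k % 5 = 0 ∨ k % 5 = 1 ∨ k % 5 = 2 ∨ k % 5 = 3 ∨ k % 5 = 4 := by omega
  have h5 : ∀ r, k % 5 = r → (3 * k - 1) % 5 = (3 * r - 1) % 5 := fun r hr => by omega
  rcases h4 with h4 | h4 | h4 | h4 | h4 <;> rw [h5 _ h4, h4] at h3 <;> omega

theorem coeff_expand_five_mul_eq_zero {R : Type*} [CommRing R] {f : R⟦X⟧} (L : R⟦X⟧)
    (hf : ∀ n : ℕ, n % 5 = 3 ∨ n % 5 = 4 → coeff n f = 0) {n : ℕ} (hn : n % 5 = 3 ∨ n % 5 = 4) :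
    coeff n (expand 5 (by norm_num) L * f) = 0 := by
  rw [coeff_mul]
  refine Finset.sum_eq_zero fun p hp => ?_
  rw [Finset.HasAntidiagonal.mem_antidiagonal] at hp
  rw [coeff_expand]
  split_ifs with h
  · rw [hf p.2 (by omega), mul_zero]
  · rw [zero_mul]

/-- The series `s` defined by `E_1 ^ 5 = E_5 (1 - 5 s)`; the level 10 identity evaluates
`s(q) - s(q²)` as an eta quotient. -/
theorem exists_eulerProd_pow_five_sub : ∃ s : ℤ⟦X⟧, constantCoeff s = 0 ∧
    eulerProd 1 ^ 5 = eulerProd 5 * (1 - 5 * s) ∧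
    eulerProd 5 ^ 2 * (s - expand 2 two_ne_zero s) =
      X * eulerProd 1 ^ 2 * eulerProd 2 * eulerProd 10 ^ 3 := by
  obtain ⟨s, hs0, hs⟩ := exists_eulerProd_pow_five
  refine ⟨s, hs0, hs, ?_⟩
  have hs2 := congrArg (expand 2 two_ne_zero) hs
  simp only [map_mul, map_pow, map_sub, map_one, map_ofNat,
    expand_eulerProd two_ne_zero one_ne_zero,
    expand_eulerProd two_ne_zero (show (5 : ℕ) ≠ 0 by norm_num), Nat.reduceMul] at hs2
  have h := eulerProd_pow_five_sub
  have n10 := eulerProd_ne_zero (k := 10) (by norm_num)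
  have h5 : (5 : ℤ⟦X⟧) ≠ 0 := fun h0 => by
    have h1 := congrArg constantCoeff h0
    rw [map_ofNat, map_zero] at h1
    norm_num at h1
  apply mul_left_cancel₀ (mul_ne_zero h5 n10)
  linear_combination eulerProd 5 * eulerProd 10 * hs - eulerProd 5 ^ 2 * hs2 - h

section Algebra

variable {A : Type*} [CommRing A]

/-- For `a = φ(q)` and `a' = φ(q ^ 5)`: the fifth power of an eta quotient modulo `25`, where `e_k`, `f_k`
and `s_k` stand for `E_k`, `E_(5 k)` and `s(q ^ k)`. -/
theorem phi_pow_five_mod (h25 : (25 : A) = 0) {a e1 e2 e4 f1 f2 f4 s1 s2 s4 a' : A}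
    (w1 : IsUnit f1) (w4 : IsUnit f4)
    (ha : a * (e1 ^ 2 * e4 ^ 2) = e2 ^ 5) (ha' : a' * (f1 ^ 2 * f4 ^ 2) = f2 ^ 5)
    (h1 : e1 ^ 5 = f1 * (1 - 5 * s1)) (h2 : e2 ^ 5 = f2 * (1 - 5 * s2))
    (h4 : e4 ^ 5 = f4 * (1 - 5 * s4)) : a ^ 5 = a' * (1 + 10 * s1 + 10 * s4) := by
  have k1 : e1 ^ 10 = f1 ^ 2 * (1 - 10 * s1) := by
    rw [show e1 ^ 10 = (e1 ^ 5) ^ 2 by ring, h1]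
    linear_combination f1 ^ 2 * s1 ^ 2 * h25
  have k4 : e4 ^ 10 = f4 ^ 2 * (1 - 10 * s4) := by
    rw [show e4 ^ 10 = (e4 ^ 5) ^ 2 by ring, h4]
    linear_combination f4 ^ 2 * s4 ^ 2 * h25
  have k2 : e2 ^ 25 = f2 ^ 5 := by
    rw [show e2 ^ 25 = (e2 ^ 5) ^ 5 by ring, h2]
    linear_combination f2 ^ 5 * (-s2 + 10 * s2 ^ 2 - 50 * s2 ^ 3 + 125 * s2 ^ 4 -
      125 * s2 ^ 5) * h25
  have k : a ^ 5 * (e1 ^ 10 * e4 ^ 10) = e2 ^ 25 := by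
    rw [show e2 ^ 25 = (e2 ^ 5) ^ 5 by ring, ← ha]; ring
  have q : a ^ 5 * ((1 - 10 * s1) * (1 - 10 * s4)) = a' := by
    apply ((w1.pow 2).mul (w4.pow 2)).mul_left_cancel
    linear_combination k - a ^ 5 * f4 ^ 2 * (1 - 10 * s4) * k1 - a ^ 5 * e1 ^ 10 * k4 + k2 - ha'
  linear_combination (1 + 10 * s1 + 10 * s4) * q + a ^ 5 * (4 * s1 ^ 2 + 4 * s4 ^ 2 +
    4 * s1 * s4 - 40 * s1 * s4 * (s1 + s4)) * h25

/-- The fifth power of the eta quotient `c = e1 ^ 2 / e2` modulo `25`. It applies to `φ(-q)`, and to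
`ψ(q ^ 2)` with `e1` replaced by `e4`. -/
theorem etaQuotient_pow_five_mod (h25 : (25 : A) = 0) {c e1 e2 f1 f2 s1 s2 c' : A}
    (w2 : IsUnit f2) (hc : c * e2 = e1 ^ 2) (hc' : c' * f2 = f1 ^ 2)
    (h1 : e1 ^ 5 = f1 * (1 - 5 * s1)) (h2 : e2 ^ 5 = f2 * (1 - 5 * s2)) :
    c ^ 5 = c' * (1 - 10 * s1 + 5 * s2) := by
  have k1 : e1 ^ 10 = f1 ^ 2 * (1 - 10 * s1) := by
    rw [show e1 ^ 10 = (e1 ^ 5) ^ 2 by ring, h1]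
    linear_combination f1 ^ 2 * s1 ^ 2 * h25
  have k : c ^ 5 * e2 ^ 5 = e1 ^ 10 := by
    rw [show e1 ^ 10 = (e1 ^ 2) ^ 5 by ring, ← hc]; ring
  have q : c ^ 5 * (1 - 5 * s2) = c' * (1 - 10 * s1) := by
    apply w2.mul_left_cancel
    linear_combination k - c ^ 5 * h2 + k1 - (1 - 10 * s1) * hc'
  linear_combination (1 + 5 * s2) * q + (c ^ 5 * s2 ^ 2 - 2 * c' * s1 * s2) * h25

/-- The eta quotient `φ(q) ψ(q ^ 2) / φ(-q)` is `E_2 ^ 5 / E_1 ^ 4`, which modulo `25` is `E_1` times a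
series in `q ^ 5`, up to a correction in `s`. -/
theorem phi_mul_psi_eq_mod {a b c e1 e2 e4 f1 f2 s1 s2 : A} (u2 : IsUnit e2)
    (u4 : IsUnit e4)
    (ha : a * (e1 ^ 2 * e4 ^ 2) = e2 ^ 5) (hb : b * e2 = e4 ^ 2) (hc : c * e2 = e1 ^ 2)
    (h1 : e1 ^ 5 = f1 * (1 - 5 * s1)) (h2 : e2 ^ 5 = f2 * (1 - 5 * s2)) :
    a * b * f1 * (1 - 5 * s1) = c * e1 * f2 * (1 - 5 * s2) := by
  have k : a * b * e1 ^ 4 = c * e2 ^ 5 := by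
    apply ((u4.pow 2).mul u2).mul_left_cancel
    linear_combination b * e2 * e1 ^ 2 * ha + e2 ^ 5 * e1 ^ 2 * hb - e2 ^ 5 * e4 ^ 2 * hc
  linear_combination e1 * k - a * b * h1 + c * e1 * h2

theorem pow_fifteen_eq (h25 : (25 : A) = 0) {c c' s1 s2 : A}
    (h : c ^ 5 = c' * (1 - 10 * s1 + 5 * s2)) : c ^ 15 = c' ^ 3 * (1 - 5 * s1 + 15 * s2) := by
  rw [show c ^ 15 = (c ^ 5) ^ 3 by ring, h]
  linear_combination c' ^ 3 * (-s1 + 3 * (s2 - 2 * s1) ^ 2 + 5 * (s2 - 2 * s1) ^ 3) * h25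

/-- Modulo `25`, the numerator is `2 b a ^ 6 (7 u ^ 2 + 3 u v + 2 v ^ 2)`, whose quadratic factor is
`7 (u ^ 2 - u v + v ^ 2) + 10 u v - 5 v ^ 2`, and all terms in `s1`, `s2`, `s4` cancel. -/
theorem series_sixteen_add_four_eq (h25 : (25 : A) = 0) {a b c e1 f1 f2 s1 s2 s4 a' c' u v G : A}
    (uc : IsUnit c) (A5 : a ^ 5 = a' * (1 + 10 * s1 + 10 * s4))
    (C5 : c ^ 5 = c' * (1 - 10 * s1 + 5 * s2))
    (AB : a * b * f1 * (1 - 5 * s1) = c * e1 * f2 * (1 - 5 * s2))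
    (hE : u ^ 2 - u * v + v ^ 2 = 1 - 10 * s2) (huv : 5 * (u * v) = 80 * (s1 - s2))
    (hvv : 5 * v ^ 2 = 1280 * (s2 - s4)) (hu : u = a ^ 4)
    (hG : G * c ^ 16 = 2 * b * (7 * a ^ 14 + 203 * a ^ 10 * v + 277 * a ^ 6 * v ^ 2 +
      25 * a ^ 2 * v ^ 3)) :
    G * (c' ^ 3 * f1) = 14 * (a' * f2) * e1 := by
  have K : 7 * u ^ 2 + 3 * (u * v) + 2 * v ^ 2 = 7 + 10 * s1 - 10 * s2 + 5 * s4 := by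
    linear_combination 7 * hE + 2 * huv - hvv + (6 * s1 - 60 * s2 + 51 * s4) * h25
  have C15 := pow_fifteen_eq h25 C5
  have F1 : G * c * (c' ^ 3 * (1 - 5 * s1 + 15 * s2)) =
      2 * (a * b) * (a' * (1 + 10 * s1 + 10 * s4)) * (7 + 10 * s1 - 10 * s2 + 5 * s4) := by
    rw [← K, ← A5, ← C15, hu]
    linear_combination hG + 2 * b * (8 * a ^ 10 * v + 11 * a ^ 6 * v ^ 2 + a ^ 2 * v ^ 3) * h25
  have F2 : G * (c' ^ 3 * f1) * ((1 - 5 * s1 + 15 * s2) * (1 - 5 * s1)) =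
      2 * (a' * f2 * e1) * ((1 - 5 * s2) * (1 + 10 * s1 + 10 * s4) *
        (7 + 10 * s1 - 10 * s2 + 5 * s4)) := by
    apply uc.mul_left_cancel
    linear_combination f1 * (1 - 5 * s1) * F1 + 2 * (a' * (1 + 10 * s1 + 10 * s4)) *
      (7 + 10 * s1 - 10 * s2 + 5 * s4) * AB
  have L : (1 - 5 * s1 + 15 * s2) * (1 - 5 * s1) = 1 - 10 * s1 + 15 * s2 := by
    linear_combination (s1 ^ 2 - 3 * s1 * s2) * h25
  have M : (1 - 5 * s2) * (1 + 10 * s1 + 10 * s4) * (7 + 10 * s1 - 10 * s2 + 5 * s4) =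
      7 * (1 - 10 * s1 + 15 * s2) := by
    linear_combination ((2 * s1 + 2 * s4 - s2) * (2 * s1 - 2 * s2 + s4) + 6 * s1 - 6 * s2 +
      3 * s4 - 2 * s2 * (s1 + s4) * (7 + 10 * s1 - 10 * s2 + 5 * s4)) * h25
  rw [L, M] at F2
  linear_combination (1 + 10 * s1 - 15 * s2) * F2 +
    (G * (c' ^ 3 * f1) - 14 * (a' * f2) * e1) * (2 * s1 - 3 * s2) ^ 2 * h25

/-- Modulo `25`, the numerator is `4 a b ^ 2 v (2 u ^ 2 + 3 u v + 7 v ^ 2)`, whose quadratic factor is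
`2 (u ^ 2 - u v + v ^ 2) + 5 u v + 5 v ^ 2`, and all terms in `s1`, `s2`, `s4` cancel. -/
theorem series_sixteen_add_eight_eq (h25 : (25 : A) = 0) {X a b c e1 f1 f2 s1 s2 s4 b' c' u v H : A}
    (uc : IsUnit c) (B5 : b ^ 5 = b' * (1 - 10 * s4 + 5 * s2))
    (C5 : c ^ 5 = c' * (1 - 10 * s1 + 5 * s2))
    (AB : a * b * f1 * (1 - 5 * s1) = c * e1 * f2 * (1 - 5 * s2))
    (hE : u ^ 2 - u * v + v ^ 2 = 1 - 10 * s2) (huv : 5 * (u * v) = 80 * (s1 - s2))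
    (hvv : 5 * v ^ 2 = 1280 * (s2 - s4)) (hu : u = a ^ 4) (hv : v = 16 * X * b ^ 4)
    (hH : H * c ^ 16 = 4 * b ^ 2 * (25 * a ^ 13 + 277 * a ^ 9 * v + 203 * a ^ 5 * v ^ 2 +
      7 * a * v ^ 3)) :
    H * (c' ^ 3 * f1) = 128 * X * (b' * f2) * e1 := by
  have K : 2 * u ^ 2 + 3 * (u * v) + 7 * v ^ 2 = 2 + 5 * s1 + 5 * s2 - 5 * s4 := by
    linear_combination 2 * hE + huv + hvv + (3 * s1 + 47 * s2 - 51 * s4) * h25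
  have C15 := pow_fifteen_eq h25 C5
  have F1 : H * c * (c' ^ 3 * (1 - 5 * s1 + 15 * s2)) =
      64 * X * (a * b) * (b' * (1 - 10 * s4 + 5 * s2)) * (2 + 5 * s1 + 5 * s2 - 5 * s4) := by
    have e : 4 * a * b ^ 2 * v = 64 * X * (a * b) * b ^ 5 := by rw [hv]; ring
    rw [← K, ← B5, ← C15, hu, ← e]
    linear_combination hH + 4 * b ^ 2 * (a ^ 13 + 11 * a ^ 9 * v + 8 * a ^ 5 * v ^ 2) * h25
  have F2 : H * (c' ^ 3 * f1) * ((1 - 5 * s1 + 15 * s2) * (1 - 5 * s1)) =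
      64 * X * (b' * f2 * e1) * ((1 - 5 * s2) * (1 - 10 * s4 + 5 * s2) *
        (2 + 5 * s1 + 5 * s2 - 5 * s4)) := by
    apply uc.mul_left_cancel
    linear_combination f1 * (1 - 5 * s1) * F1 + 64 * X * (b' * (1 - 10 * s4 + 5 * s2)) *
      (2 + 5 * s1 + 5 * s2 - 5 * s4) * AB
  have L : (1 - 5 * s1 + 15 * s2) * (1 - 5 * s1) = 1 - 10 * s1 + 15 * s2 := by
    linear_combination (s1 ^ 2 - 3 * s1 * s2) * h25
  have M : (1 - 5 * s2) * (1 - 10 * s4 + 5 * s2) * (2 + 5 * s1 + 5 * s2 - 5 * s4) =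
      2 * (1 - 10 * s1 + 15 * s2) := by
    linear_combination ((-2 * s4) * (s1 + s2 - s4) + s1 - s2 - s4 +
      (2 * s2 * s4 - s2 ^ 2) * (2 + 5 * s1 + 5 * s2 - 5 * s4)) * h25
  rw [L, M] at F2
  linear_combination (1 + 10 * s1 - 15 * s2) * F2 +
    (H * (c' ^ 3 * f1) - 128 * X * (b' * f2) * e1) * (2 * s1 - 3 * s2) ^ 2 * h25

end Algebra

/-! ### Reduction modulo 25 and the congruences -/

/-- Reduction of the coefficients modulo `25`. -/
noncomputable def redHom : ℤ⟦X⟧ →+* (ZMod 25)⟦X⟧ := map (Int.castRingHom (ZMod 25))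

theorem twentyFive_eq_zero : (25 : (ZMod 25)⟦X⟧) = 0 := by
  rw [← map_ofNat (C (R := ZMod 25)), show (OfNat.ofNat 25 : ZMod 25) = 0 from rfl, map_zero]

theorem redHom_X : redHom X = X := map_X _

theorem redHom_expand {d : ℕ} (hd : d ≠ 0) (f : ℤ⟦X⟧) :
    redHom (expand d hd f) = expand d hd (redHom f) := map_expand _ _ _ _

theorem isUnit_redHom_eulerProd {k : ℕ} (hk : k ≠ 0) : IsUnit (redHom (eulerProd k)) :=
  (isUnit_of_constantCoeff_eq_one (constantCoeff_eulerProd hk)).map redHom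

/-- Evaluation modulo `25` of the quadratic forms in `u` and `v` that occur in the two sections. -/
theorem redHom_relations {s b u v : ℤ⟦X⟧} (hs0 : constantCoeff s = 0)
    (hs : eulerProd 1 ^ 5 = eulerProd 5 * (1 - 5 * s))
    (hs' : eulerProd 5 ^ 2 * (s - expand 2 two_ne_zero s) =
      X * eulerProd 1 ^ 2 * eulerProd 2 * eulerProd 10 ^ 3)
    (hb : b = expand 2 two_ne_zero psi) (hu : u = phi ^ 4) (hv : v = 16 * X * b ^ 4) :
    redHom (u ^ 2 - u * v + v ^ 2) = redHom (1 - 10 * expand 2 two_ne_zero s) ∧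
    redHom (5 * (u * v)) = redHom (80 * (s - expand 2 two_ne_zero s)) ∧
    redHom (5 * v ^ 2) = redHom (1280 * (expand 2 two_ne_zero s - expand 4 four_ne_zero s)) := by
  have h25 := twentyFive_eq_zero
  have ue := isUnit_redHom_eulerProd one_ne_zero
  have hs2 := congrArg (expand 2 two_ne_zero) hs
  simp only [map_mul, map_pow, map_sub, map_one, map_ofNat,
    expand_eulerProd two_ne_zero one_ne_zero,
    expand_eulerProd two_ne_zero (show (5 : ℕ) ≠ 0 by norm_num), Nat.reduceMul] at hs2
  -- modulo `5` one has `E_5 = E_1⁵` and `E_10 = E_2⁵`, which turns the eta quotient into `q ψ(q)⁸`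
  have hS : redHom (5 * (s - expand 2 two_ne_zero s)) = redHom (5 * X * psi ^ 8) := by
    have q1 := congrArg redHom hs
    have q2 := congrArg redHom hs2
    have q3 := congrArg redHom hs'
    have q4 := congrArg redHom psi_mul_eulerProd
    simp only [map_mul, map_pow, map_sub, map_one, map_ofNat] at q1 q2 q3 q4 ⊢
    generalize redHom (eulerProd 1) = e1 at *
    generalize redHom (eulerProd 2) = e2 at *
    generalize redHom (eulerProd 5) = f1 at *
    generalize redHom (eulerProd 10) = f2 at *
    generalize redHom (expand 2 _ s) = s2 at *
    generalize redHom s = s1 at *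
    generalize redHom psi = P at *
    have k1 : 5 * f1 = 5 * e1 ^ 5 := by linear_combination -5 * q1 + f1 * s1 * h25
    have k2 : 5 * f2 = 5 * e2 ^ 5 := by linear_combination -5 * q2 + f2 * s2 * h25
    have k3 : 5 * f1 ^ 2 = 5 * e1 ^ 10 := by linear_combination (f1 + e1 ^ 5) * k1
    have k4 : 5 * f2 ^ 3 = 5 * e2 ^ 15 := by
      linear_combination (f2 ^ 2 + f2 * e2 ^ 5 + e2 ^ 10) * k2
    have k5 : e2 ^ 16 = (P * e1) ^ 8 := by rw [q4]; ring
    apply (ue.pow 10).mul_left_cancel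
    linear_combination 5 * q3 - (s1 - s2) * k3 + redHom X * e1 ^ 2 * e2 * k4 +
      5 * redHom X * e1 ^ 2 * k5
  have huv' : u * v = 16 * X * psi ^ 8 := by
    rw [hu, hv, show psi ^ 8 = (psi ^ 2) ^ 4 by ring, ← phi_mul_expand_psi, hb]; ring
  have huv : redHom (5 * (u * v)) = redHom (80 * (s - expand 2 two_ne_zero s)) := by
    rw [huv']
    simp only [map_mul, map_pow, map_sub, map_ofNat] at hS ⊢
    linear_combination -16 * hS
  refine ⟨?_, huv, ?_⟩
  · have hE := expand_two_eisenstein hu (hb ▸ hv)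
    -- `T = u² + 14uv + v² - 1 + 10s` is fixed by `q ↦ q²`: `T(q) - T(q²) = 15uv + 10(s(q) - s(q²))`.
    have hT : redHom (u ^ 2 + 14 * u * v + v ^ 2 - 1 + 10 * s) = 0 := by
      refine eq_zero_of_eq_mul_expand (u := 1) ?_ ?_
      · rw [map_one, one_mul, ← redHom_expand, map_add (expand 2 _), map_sub (expand 2 _), hE]
        simp only [map_add, map_mul, map_pow, map_sub, map_one, map_ofNat] at huv ⊢
        linear_combination 3 * huv + 10 * (redHom s - redHom (expand 2 two_ne_zero s)) * h25
      · have hc : constantCoeff (u ^ 2 + 14 * u * v + v ^ 2 - 1 + 10 * s) = 0 := by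
          rw [hu, hv]
          simp [constantCoeff_phi, hs0]
        rw [redHom, ← coeff_zero_eq_constantCoeff_apply, coeff_map,
          coeff_zero_eq_constantCoeff_apply, hc, map_zero]
    have h2 := congrArg (expand 2 two_ne_zero) hT
    rw [← redHom_expand, map_add (expand 2 _), map_sub (expand 2 _), hE] at h2
    simp only [map_add, map_mul, map_pow, map_sub, map_one, map_ofNat, map_zero] at h2 ⊢
    linear_combination h2
  · have h2 := congrArg (expand 2 two_ne_zero) hS
    rw [← redHom_expand, ← redHom_expand] at h2
    simp only [map_mul, map_pow, map_sub, map_ofNat, expand_X, expand_expand_two, ← hb] at h2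
    rw [hv]
    simp only [map_mul, map_pow, map_sub, map_ofNat]
    linear_combination -256 * h2

/-- Modulo `25`, the generating functions of `overpartitionCount (16 * n + 4)` and of
`overpartitionCount (16 * n + 8)` are `E_1`, respectively `q E_1`, times a series in `q ^ 5`. -/
theorem exists_redHom_eq : ∃ (G H : ℤ⟦X⟧) (K L : (ZMod 25)⟦X⟧),
    (∀ n, coeff n G = overpartitionCount (16 * n + 4)) ∧
    (∀ n, coeff n H = overpartitionCount (16 * n + 8)) ∧
    redHom G = expand 5 (by norm_num) K * redHom (eulerProd 1) ∧
    redHom H = X * (expand 5 (by norm_num) L * redHom (eulerProd 1)) := by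
  have h5 : (5 : ℕ) ≠ 0 := by norm_num
  obtain ⟨s, hs0, hs, hs'⟩ := exists_eulerProd_pow_five_sub
  obtain ⟨G, H, hG, hH, hGc, hHc⟩ := exists_series_sixteen_mul rfl rfl
  obtain ⟨hE, huv, hvv⟩ := redHom_relations hs0 hs hs' rfl rfl rfl
  have ha := phi_mul_eulerProd
  have hc := phiNeg_mul_eulerProd
  have hb := congrArg (expand 2 two_ne_zero) psi_mul_eulerProd
  have hs2 := congrArg (expand 2 two_ne_zero) hs
  have hs4 := congrArg (expand 4 four_ne_zero) hs
  simp only [map_mul, map_pow, map_sub, map_one, map_ofNat,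
    expand_eulerProd two_ne_zero one_ne_zero, expand_eulerProd two_ne_zero two_ne_zero,
    expand_eulerProd four_ne_zero one_ne_zero, expand_eulerProd four_ne_zero h5,
    expand_eulerProd two_ne_zero h5, Nat.reduceMul] at hb hs2 hs4
  have ha' := congrArg (expand 5 h5) ha
  have hb' := congrArg (expand 5 h5) hb
  have hc' := congrArg (expand 5 h5) hc
  simp only [map_mul, map_pow, expand_eulerProd h5 one_ne_zero, expand_eulerProd h5 two_ne_zero,
    expand_eulerProd h5 four_ne_zero, Nat.reduceMul] at ha' hb' hc'
  replace ha := congrArg redHom ha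
  replace hb := congrArg redHom hb
  replace hc := congrArg redHom hc
  replace ha' := congrArg redHom ha'
  replace hb' := congrArg redHom hb'
  replace hc' := congrArg redHom hc'
  replace hs := congrArg redHom hs
  replace hs2 := congrArg redHom hs2
  replace hs4 := congrArg redHom hs4
  replace hG := congrArg redHom hG
  replace hH := congrArg redHom hH
  simp only [map_mul, map_pow, map_sub, map_add, map_one, map_ofNat, redHom_X] at *
  have h25 := twentyFive_eq_zero
  have uc : IsUnit (redHom phiNeg) := isUnit_phiNeg.map redHom
  have u (k : ℕ) (hk : k ≠ 0) := isUnit_redHom_eulerProd hk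
  have A5 := phi_pow_five_mod h25 (u 5 (by norm_num)) (u 20 (by norm_num)) ha ha' hs
    hs2 hs4
  have B5 := etaQuotient_pow_five_mod h25 (u 10 (by norm_num)) hb hb' hs4 hs2
  have C5 := etaQuotient_pow_five_mod h25 (u 10 (by norm_num)) hc hc' hs hs2
  have AB := phi_mul_psi_eq_mod (u 2 (by norm_num)) (u 4 (by norm_num)) ha hb hc hs hs2
  have hG' := series_sixteen_add_four_eq h25 uc A5 C5 AB hE huv hvv rfl hG
  have hH' := series_sixteen_add_eight_eq h25 uc B5 C5 AB hE huv hvv rfl rfl hH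
  obtain ⟨w, hw⟩ := isUnit_iff_exists_inv.mp ((uc.pow 3).mul (u 1 one_ne_zero))
  have hw5 := congrArg (expand 5 h5) hw
  have e1 : expand 5 h5 (redHom (eulerProd 1)) = redHom (eulerProd 5) := by
    rw [← redHom_expand, expand_eulerProd h5 one_ne_zero, mul_one]
  have e2 : expand 5 h5 (redHom (eulerProd 2)) = redHom (eulerProd 10) := by
    rw [← redHom_expand, expand_eulerProd h5 two_ne_zero]
  rw [map_mul, map_mul, map_pow, ← redHom_expand, e1, map_one] at hw5
  refine ⟨G, H, 14 * (redHom phi * redHom (eulerProd 2)) * w,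
    128 * (redHom (expand 2 two_ne_zero psi) * redHom (eulerProd 2)) * w, hGc, hHc, ?_, ?_⟩
  · simp only [map_mul, map_ofNat, e2, ← redHom_expand h5]
    linear_combination expand 5 h5 w * hG' - redHom G * hw5
  · simp only [map_mul, map_ofNat, e2, ← redHom_expand h5]
    linear_combination expand 5 h5 w * hH' - redHom H * hw5

theorem overpartitionCount_modEq_zero {G : ℤ⟦X⟧} {n N : ℕ} (hG : coeff n G = overpartitionCount N)
    (h : coeff n (redHom G) = 0) : overpartitionCount N ≡ 0 [MOD 25] := by
  rw [redHom, coeff_map, hG, eq_intCast, Int.cast_natCast] at h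
  exact (Nat.modEq_zero_iff_dvd).mpr ((ZMod.natCast_eq_zero_iff _ _).mp h)

theorem theorem1 (n : ℕ) :
    overpartitionCount (80 * n + 8) ≡ 0 [MOD 25] ∧
    overpartitionCount (80 * n + 52) ≡ 0 [MOD 25] ∧
    overpartitionCount (80 * n + 68) ≡ 0 [MOD 25] ∧
    overpartitionCount (80 * n + 72) ≡ 0 [MOD 25] := by
  obtain ⟨G, H, K, L, hGc, hHc, hG, hH⟩ := exists_redHom_eq
  have hE : ∀ m : ℕ, m % 5 = 3 ∨ m % 5 = 4 → coeff m (redHom (eulerProd 1)) = 0 := fun m hm => by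
    rw [redHom, coeff_map, coeff_eulerProd_eq_zero hm, map_zero]
  have hG0 : ∀ m : ℕ, m % 5 = 3 ∨ m % 5 = 4 → coeff m (redHom G) = 0 := fun m hm => by
    rw [hG]; exact coeff_expand_five_mul_eq_zero K hE hm
  have hH0 : ∀ m : ℕ, m % 5 = 0 ∨ m % 5 = 4 → coeff m (redHom H) = 0 := fun m hm => by
    rw [hH]
    rcases m with _ | m
    · simp
    · rw [coeff_succ_X_mul]
      exact coeff_expand_five_mul_eq_zero L hE (by omega)
  refine ⟨?_, ?_, ?_, ?_⟩
  · rw [show 80 * n + 8 = 16 * (5 * n) + 8 by ring]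
    exact overpartitionCount_modEq_zero (hHc _) (hH0 _ (by omega))
  · rw [show 80 * n + 52 = 16 * (5 * n + 3) + 4 by ring]
    exact overpartitionCount_modEq_zero (hGc _) (hG0 _ (by omega))
  · rw [show 80 * n + 68 = 16 * (5 * n + 4) + 4 by ring]
    exact overpartitionCount_modEq_zero (hGc _) (hG0 _ (by omega))
  · rw [show 80 * n + 72 = 16 * (5 * n + 4) + 8 by ring]
    exact overpartitionCount_modEq_zero (hHc _) (hH0 _ (by omega))
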